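/- Let $X$ be a complex symplectic manifold and let $\mathcal{A}_X$ be a DQ-algebra quantizing it: a sheaf of $\mathbb{C}[[\hbar]]$-algebras locally isomorphic to a star-algebra $(\mathcal{O}_X[[\hbar]],\star)$, and such that the Poisson bracket $\{\sigma_0(a),\sigma_0(b)\}=\sigma_0(\hbar^{-1}(ab-ba))$ on $\mathcal{A}_X/\hbar\mathcal{A}_X\simeq\mathcal{O}_X$ is the one defined by the symplectic form. Let $(\pi,\iota,\mathcal{L})$ be a polarization of $(X,\mathcal{A}_X)$, that is: $\pi\colon X\to\Lambda$ is a holomorphic fibre bundle with Lagrangian fibres over a complex manifold $\Lambda$, $\iota\colon\Lambda\to X$ is a Lagrangian immersion with $\pi\circ\iota=\mathrm{id}_\Lambda$, and $\mathcal{L}$ is an $\mathcal{A}_X$-module which is simple along $\iota(\Lambda)$ (it is coherent and supported by $\iota(\Lambda)$, the complex $\mathrm{gr}_\hbar\mathcal{L}=\mathbb{C}\otimes^{\mathrm{L}}_{\mathbb{C}[[\hbar]]}\mathcal{L}$ is concentrated in degree $0$, and $\mathcal{L}/\hbar\mathcal{L}$ is an invertible $\mathcal{O}_\Lambda$-module).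 Let $k$ be a commutative ring over which $\mathbb{C}[[\hbar]]$ is an algebra (for instance $k=\mathbb{C}$ or $k=\mathbb{C}[[\hbar]]$), let $\mathcal{R}_\Lambda$ be a coherent sheaf of $k$-algebras on $\Lambda$, let $\phi\colon\pi^{-1}\mathcal{R}_\Lambda\hookrightarrow\mathcal{A}_X$ be a monomorphism of $k$-algebras, and let $\mathcal{L}_\Lambda$ be an $\mathcal{R}_\Lambda$-module. Write $\mathcal{M}^{\mathcal{A}_X}=\mathcal{A}_X\otimes_{\pi^{-1}\mathcal{R}_\Lambda}\pi^{-1}\mathcal{M}$. Assume that $(\phi,\mathcal{L}_\Lambda)$ is compatible with the polarization: 1. the functor $\mathcal{M}\mapsto\mathcal{M}^{\mathcal{A}_X}$ is exact on coherent modules: for every open subset $U\subset\Lambda$, it sends short exact sequences of coherent $\mathcal{R}_\Lambda|_U$-modules to exact sequences of $\mathcal{A}_X|_{\pi^{-1}(U)}$-modules; 2. $\pi_*\mathcal{L}$ and $\mathcal{L}_\Lambda$ are isomorphic as $\mathcal{R}_\Lambda$-modules. Then, for every coherent $\mathcal{R}_\Lambda$-module $\mathcal{M}$, there is an isomorphism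 $$\mathrm{R}\mathcal{H}om_{\mathcal{R}_\Lambda}(\mathcal{M},\mathcal{L}_\Lambda)\;\simeq\;\mathrm{R}\pi_*\,\mathrm{R}\mathcal{H}om_{\mathcal{A}_X}(\mathcal{M}^{\mathcal{A}_X},\mathcal{L})$$ in the bounded below derived category of sheaves of $k$-modules on $\Lambda$. -/

import Mathlib

open CategoryTheory Limits TopologicalSpace Opposite
open scoped ContDiff Manifold

universe u w

noncomputable section

namespace DQ

/-! ### Sheaves of rings, of algebras and of modules -/

/-- The category of sheaves of (not necessarily commutative) rings on a space. -/
abbrev RingSheaf (X : TopCat.{u}) := CategoryTheory.Sheaf (Opens.grothendieckTopology X) RingCat.{u}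

/-- The category of sheaves of `k`-modules on a space. -/
abbrev KSheaf (k : Type u) [CommRing k] (X : TopCat.{u}) :=
  CategoryTheory.Sheaf (Opens.grothendieckTopology X) (ModuleCat.{u} k)

section RingSheaves

variable {X Y : TopCat.{u}}

/-- The direct image of a sheaf of rings. -/
abbrev pushRing (f : X ⟶ Y) (A : RingSheaf X) : RingSheaf Y :=
  ((Opens.map f).sheafPushforwardContinuous RingCat.{u} (Opens.grothendieckTopology Y)
    (Opens.grothendieckTopology X)).obj A

/-- The inverse image `f⁻¹ R` of a sheaf of rings. -/
abbrev pullRing (f : X ⟶ Y) (R : RingSheaf Y) : RingSheaf X :=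
  ((Opens.map f).sheafPullback RingCat.{u} (Opens.grothendieckTopology Y)
    (Opens.grothendieckTopology X)).obj R

/-- The morphism `R ⟶ f_* A` that corresponds to a morphism `f⁻¹ R ⟶ A`. -/
abbrev adjRing (f : X ⟶ Y) {R : RingSheaf Y} {A : RingSheaf X}
    (φ : pullRing f R ⟶ A) : R ⟶ pushRing f A :=
  ((Opens.map f).sheafAdjunctionContinuous RingCat.{u} (Opens.grothendieckTopology Y)
    (Opens.grothendieckTopology X)).homEquiv R A φ

instance pushforward_isRightAdjoint (f : X ⟶ Y) {R : RingSheaf Y} {A : RingSheaf X}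
    (φ : R ⟶ pushRing f A) : (SheafOfModules.pushforward.{u} φ).IsRightAdjoint :=
  haveI : (PresheafOfModules.pushforward.{u} φ.hom).IsRightAdjoint :=
    PresheafOfModules.instIsRightAdjointPushforward _
  (SheafOfModules.PullbackConstruction.adjunction.{u} φ).isRightAdjoint

/-- For `φ : f⁻¹ R ⟶ A`, the direct image `f_* N` of an `A`-module, as an `R`-module. -/
abbrev pushMod (f : X ⟶ Y) {R : RingSheaf Y} {A : RingSheaf X}
    (φ : pullRing f R ⟶ A) : SheafOfModules.{u} A ⥤ SheafOfModules.{u} R :=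
  SheafOfModules.pushforward.{u} (adjRing f φ)

/-- For `φ : f⁻¹ R ⟶ A`, the extension of scalars `M ↦ A ⊗_{f⁻¹ R} f⁻¹ M`
(the inverse image functor of modules, left adjoint to `N ↦ f_* N`). -/
abbrev extendScalars (f : X ⟶ Y) {R : RingSheaf Y} {A : RingSheaf X}
    (φ : pullRing f R ⟶ A) : SheafOfModules.{u} R ⥤ SheafOfModules.{u} A :=
  SheafOfModules.pullback.{u} (adjRing f φ)

end RingSheaves

/-! ### Enough injectives -/

section EnoughInjectives

variable {X : TopCat.{u}} (R : RingSheaf X)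

instance presheafOfModules_ab5 (R₀ : (Opens X)ᵒᵖ ⥤ RingCat.{u}) (J : Type u) [SmallCategory J]
    [IsFiltered J] : HasExactColimitsOfShape J (PresheafOfModules.{u} R₀) := by
  exact HasExactColimitsOfShape.domain_of_functor J (PresheafOfModules.toPresheaf R₀)

instance sheafOfModules_ab5 : AB5OfSize.{u, u} (SheafOfModules.{u} R) where
  ofShape J _ _ := by
    exact (PresheafOfModules.sheafificationAdjunction (𝟙 R.obj)).hasExactColimitsOfShape J

/-- The free sheaf of modules on (the sheaf associated with) the open subset `U`. -/
def freeOn (U : Opens X) : SheafOfModules.{u} R :=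
  (PresheafOfModules.sheafification (𝟙 R.obj)).obj
    ((PresheafOfModules.free R.obj).obj (yoneda.obj U))

lemma freeOn_isSeparating : ObjectProperty.IsSeparating (.ofObj (freeOn R)) := by
  intro F G f g hfg
  apply (SheafOfModules.forget R).map_injective
  apply (PresheafOfModules.restrictScalars (𝟙 R.obj)).map_injective
  refine PresheafOfModules.freeYoneda.isSeparating R.obj _ _ ?_
  rintro _ ⟨U⟩ a
  have key := hfg _ (ObjectProperty.ofObj_apply _ U)
    (((PresheafOfModules.sheafificationAdjunction (𝟙 R.obj)).homEquiv _ _).symm a)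
  apply ((PresheafOfModules.sheafificationAdjunction (𝟙 R.obj)).homEquiv _ _).symm.injective
  have h1 := (PresheafOfModules.sheafificationAdjunction (𝟙 R.obj)).homEquiv_naturality_right_symm
    a f
  have h2 := (PresheafOfModules.sheafificationAdjunction (𝟙 R.obj)).homEquiv_naturality_right_symm
    a g
  exact h1.trans (key.trans h2.symm)

instance sheafOfModules_hasSeparator : HasSeparator (SheafOfModules.{u} R) where
  hasSeparator := ⟨_, (freeOn_isSeparating R).isSeparator_coproduct⟩

instance sheafOfModules_isGrothendieckAbelian :
    IsGrothendieckAbelian.{u} (SheafOfModules.{u} R) where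

end EnoughInjectives
/-- A sheaf of (not necessarily commutative) algebras over a commutative ring `K`. -/
structure AlgSheaf (K : Type w) [CommRing K] (X : TopCat.{u}) where
  /-- the underlying sheaf of rings -/
  toRing : RingSheaf X
  /-- the algebra structure on sections -/
  algebra (U : Opens X) : Algebra K (toRing.obj.obj (op U))
  /-- restriction maps are algebra maps -/
  map_algebraMap {V U : Opens X} (h : V ≤ U) (c : K) :
    (toRing.obj.map (homOfLE h).op).hom (algebraMap K (toRing.obj.obj (op U)) c) =
      algebraMap K (toRing.obj.obj (op V)) c

attribute [instance] AlgSheaf.algebra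

/-- The sections of a sheaf of rings. -/
abbrev RSec {X : TopCat.{u}} (R : RingSheaf X) (U : Opens X) : Type u := R.obj.obj (op U)

/-- Restriction of sections of a sheaf of rings. -/
abbrev rres {X : TopCat.{u}} (R : RingSheaf X) {V U : Opens X} (h : V ≤ U) :
    RSec R U →+* RSec R V := (R.obj.map (homOfLE h).op).hom

section Sections

variable {X : TopCat.{u}} {R : RingSheaf X} (M : SheafOfModules.{u} R)

/-- The sections of a sheaf of modules. -/
abbrev Sec (U : Opens X) : Type u := M.val.obj (op U)

/-- Restriction of sections of a sheaf of modules. -/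
def res {V U : Opens X} (h : V ≤ U) : Sec M U →+ Sec M V where
  toFun m := (M.val.map (homOfLE h).op).hom m
  map_zero' := map_zero _
  map_add' := map_add _

variable {M}

lemma res_smul {V U : Opens X} (h : V ≤ U) (a : RSec R U) (m : Sec M U) :
    res M h (a • m) = rres R h a • res M h m :=
  PresheafOfModules.map_smul M.val (homOfLE h).op a m

lemma res_res {W V U : Opens X} (h : W ≤ V) (h' : V ≤ U) (m : Sec M U) :
    res M h (res M h' m) = res M (h.trans h') m := by
  have := ConcreteCategory.congr_hom (M.val.presheaf.map_comp (homOfLE h').op (homOfLE h).op) m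
  exact this.symm

lemma res_self {U : Opens X} (m : Sec M U) : res M le_rfl m = m := by
  exact ConcreteCategory.congr_hom (M.val.presheaf.map_id (op U)) m

/-- The map on sections of a morphism of sheaves of modules. -/
abbrev app {M N : SheafOfModules.{u} R} (f : M ⟶ N) (U : Opens X) :
    Sec M U →ₗ[RSec R U] Sec N U := (f.val.app (op U)).hom

lemma app_res {M N : SheafOfModules.{u} R} (f : M ⟶ N) {V U : Opens X} (h : V ≤ U)
    (m : Sec M U) : app f V (res M h m) = res N h (app f U m) :=
  PresheafOfModules.naturality_apply f.val (homOfLE h).op m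

lemma sec_glue {ι : Type u} (U : ι → Opens X) (V : Opens X) (hU : ∀ i, U i ≤ V)
    (hV : V ≤ iSup U) (s : ∀ i, Sec M (U i))
    (hs : ∀ i j (W : Opens X) (hi : W ≤ U i) (hj : W ≤ U j), res M hi (s i) = res M hj (s j)) :
    ∃ t : Sec M V, ∀ i, res M (hU i) t = s i := by
  obtain ⟨t, ht, -⟩ := TopCat.Sheaf.existsUnique_gluing' (X := X)
    (⟨M.val.presheaf, M.isSheaf⟩ : TopCat.Sheaf Ab.{u} X) U V (fun i => homOfLE (hU i)) hV s
    (fun i j => hs i j (U i ⊓ U j) inf_le_left inf_le_right)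
  exact ⟨t, ht⟩

lemma sec_ext {ι : Type u} (U : ι → Opens X) (V : Opens X) (hU : ∀ i, U i ≤ V)
    (hV : V ≤ iSup U) (s t : Sec M V) (h : ∀ i, res M (hU i) s = res M (hU i) t) : s = t :=
  TopCat.Sheaf.eq_of_locally_eq' (X := X)
    (⟨M.val.presheaf, M.isSheaf⟩ : TopCat.Sheaf Ab.{u} X) U V (fun i => homOfLE (hU i)) hV s t h

end Sections

section HomSheaf

variable {K : Type w} [CommRing K] (k : Type u) [CommRing k] [Algebra k K] {X : TopCat.{u}}
  (A : AlgSheaf K X)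

/-- The sections of a sheaf of `A`-modules form a `k`-module, via `k → K → A`. -/
abbrev secModule (M : SheafOfModules.{u} A.toRing) (U : Opens X) : Module k (Sec M U) :=
  Module.compHom (Sec M U) ((algebraMap K (RSec A.toRing U)).comp (algebraMap k K))

attribute [local instance] secModule

lemma ksmul_def (M : SheafOfModules.{u} A.toRing) (U : Opens X) (c : k) (m : Sec M U) :
    c • m = (algebraMap K (RSec A.toRing U) (algebraMap k K c)) • m := rfl

lemma res_ksmul (M : SheafOfModules.{u} A.toRing) {V U : Opens X} (h : V ≤ U) (c : k)
    (m : Sec M U) : res M h (c • m) = c • res M h m := by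
  rw [ksmul_def, ksmul_def, res_smul, A.map_algebraMap]

variable (M N : SheafOfModules.{u} A.toRing)

/-- The `k`-module of morphisms of sheaves of `A`-modules `M|_U ⟶ N|_U`: families of `A(V)`-linear
maps `M(V) → N(V)`, for `V ⊆ U` open, that commute with restrictions. -/
def localHom (U : Opens X) :
    Submodule k ((V : {V : Opens X // V ≤ U}) → Sec M V.1 → Sec N V.1) where
  carrier := {f | ∀ (V : Opens X) (h : V ≤ U),
    (∀ m m' : Sec M V, f ⟨V, h⟩ (m + m') = f ⟨V, h⟩ m + f ⟨V, h⟩ m') ∧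
    (∀ (a : RSec A.toRing V) (m : Sec M V), f ⟨V, h⟩ (a • m) = a • f ⟨V, h⟩ m) ∧
    (∀ (W : Opens X) (h' : W ≤ V) (m : Sec M V),
      f ⟨W, h'.trans h⟩ (res M h' m) = res N h' (f ⟨V, h⟩ m))}
  zero_mem' := fun V h => ⟨fun _ _ => (add_zero _).symm, fun a _ => (smul_zero a).symm,
    fun W h' _ => (map_zero (res N h')).symm⟩
  add_mem' := by
    intro f g hf hg V h
    obtain ⟨f1, f2, f3⟩ := hf V h
    obtain ⟨g1, g2, g3⟩ := hg V h
    refine ⟨fun m m' => ?_, fun a m => ?_, fun W h' m => ?_⟩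
    · simp only [Pi.add_apply, f1, g1]; abel
    · simp only [Pi.add_apply, f2, g2, smul_add]
    · simp only [Pi.add_apply, f3, g3]
      exact (map_add (res N h') _ _).symm
  smul_mem' := by
    intro c f hf V h
    obtain ⟨f1, f2, f3⟩ := hf V h
    refine ⟨fun m m' => ?_, fun a m => ?_, fun W h' m => ?_⟩
    · simp only [Pi.smul_apply, f1, smul_add]
    · simp only [Pi.smul_apply, f2, ksmul_def, smul_smul, Algebra.commutes]
    · simp only [Pi.smul_apply, f3]
      rw [res_ksmul]

/-- Restriction of local morphisms. -/
def localHomRes {U' U : Opens X} (hU : U' ≤ U) : localHom k A M N U →ₗ[k] localHom k A M N U' where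
  toFun f := ⟨fun V => f.1 ⟨V.1, V.2.trans hU⟩, fun V h => f.2 V (h.trans hU)⟩
  map_add' _ _ := rfl
  map_smul' _ _ := rfl

/-- The presheaf `U ↦ Hom_{A|_U}(M|_U, N|_U)`. -/
def homPresheaf : (Opens X)ᵒᵖ ⥤ ModuleCat.{u} k where
  obj U := ModuleCat.of k (localHom k A M N U.unop)
  map i := ModuleCat.ofHom (localHomRes k A M N i.unop.le)

variable {k A M N} in
lemma localHom_glue {ι : Type u} (U : ι → Opens X) (f : ∀ i, localHom k A M N (U i))
    (hf : ∀ i j (W : Opens X) (hi : W ≤ U i) (hj : W ≤ U j),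
      (f i).1 ⟨W, hi⟩ = (f j).1 ⟨W, hj⟩) :
    ∃! g : localHom k A M N (iSup U), ∀ i, localHomRes k A M N (le_iSup U i) g = f i := by
  have cov : ∀ V : Opens X, V ≤ iSup U → V ≤ ⨆ i, V ⊓ U i := fun V h => by
    rw [← inf_iSup_eq]; exact le_inf le_rfl h
  have ex : ∀ (V : {V : Opens X // V ≤ iSup U}) (m : Sec M V.1), ∃ t : Sec N V.1,
      ∀ i, res N inf_le_left t = (f i).1 ⟨V.1 ⊓ U i, inf_le_right⟩ (res M inf_le_left m) := by
    intro V m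
    refine sec_glue (fun i => V.1 ⊓ U i) V.1 (fun i => inf_le_left) (cov _ V.2) _ ?_
    intro i j W hi hj
    refine (((f i).2 _ inf_le_right).2.2 W hi _).symm.trans ?_
    refine Eq.trans ?_ (((f j).2 _ inf_le_right).2.2 W hj _)
    rw [res_res, res_res]
    exact congrFun (hf i j W (hi.trans inf_le_right) (hj.trans inf_le_right)) _
  choose g hg using ex
  have uniq : ∀ (V : {V : Opens X // V ≤ iSup U}) (s t : Sec N V.1),
      (∀ i, res N (inf_le_left : V.1 ⊓ U i ≤ V.1) s = res N inf_le_left t) → s = t :=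
    fun V s t h => sec_ext (fun i => V.1 ⊓ U i) V.1 (fun i => inf_le_left) (cov _ V.2) s t h
  refine ⟨⟨g, ?_⟩, ?_, ?_⟩
  · intro V h
    refine ⟨fun m m' => uniq ⟨V, h⟩ _ _ fun i => ?_, fun a m => uniq ⟨V, h⟩ _ _ fun i => ?_,
      fun W h' m => uniq ⟨W, h'.trans h⟩ _ _ fun i => ?_⟩
    · rw [hg, map_add, ((f i).2 _ _).1, map_add, hg, hg]
    · rw [hg, res_smul, ((f i).2 _ _).2.1, res_smul, hg]
    · have hWV : W ⊓ U i ≤ V ⊓ U i := inf_le_inf_right _ h'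
      rw [hg, res_res, res_res]
      have h1 := congrArg (res N hWV) (hg ⟨V, h⟩ m i)
      rw [res_res] at h1
      refine Eq.trans ?_ h1.symm
      refine Eq.trans ?_ (((f i).2 _ inf_le_right).2.2 _ hWV _)
      rw [res_res]
  · intro i
    refine Subtype.ext (funext fun V => funext fun m => ?_)
    refine uniq ⟨V.1, V.2.trans (le_iSup U i)⟩ _ _ fun j => ?_
    refine (hg ⟨V.1, V.2.trans (le_iSup U i)⟩ m j).trans ?_
    refine Eq.trans ?_ (((f i).2 V.1 V.2).2.2 _ inf_le_left m)
    exact congrFun (hf j i _ inf_le_right (inf_le_left.trans V.2)) _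
  · intro g' hg'
    refine Subtype.ext (funext fun V => funext fun m => ?_)
    refine uniq V _ _ fun i => ?_
    rw [hg V m i]
    refine ((g'.2 V.1 V.2).2.2 _ inf_le_left m).symm.trans ?_
    exact congrFun (congrFun (congrArg Subtype.val (hg' i)) ⟨V.1 ⊓ U i, inf_le_right⟩) _

lemma homPresheaf_isSheaf :
    Presheaf.IsSheaf (Opens.grothendieckTopology X) (homPresheaf k A M N) := by
  change TopCat.Presheaf.IsSheaf (X := X) (homPresheaf k A M N)
  rw [TopCat.Presheaf.isSheaf_iff_isSheaf_comp (forget (ModuleCat.{u} k))]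
  apply TopCat.Presheaf.isSheaf_of_isSheafUniqueGluing_types
  intro ι U f hf
  refine localHom_glue (k := k) U f fun i j W hi hj => ?_
  exact congrFun (congrArg Subtype.val (hf i j)) ⟨W, le_inf hi hj⟩

/-- The sheaf of homomorphisms `U ↦ Hom_{A|_U}(M|_U, N|_U)`, as a functor of `N`, with values
in sheaves of `k`-modules. -/
def homSheaf : SheafOfModules.{u} A.toRing ⥤ KSheaf k X where
  obj N := ⟨homPresheaf k A M N, homPresheaf_isSheaf k A M N⟩
  map {N N'} g := ⟨
    { app := fun U => ModuleCat.ofHom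
        { toFun := fun f => ⟨fun V m => app g V.1 (f.1 V m), fun V h => by
            obtain ⟨f1, f2, f3⟩ := f.2 V h
            refine ⟨fun m m' => ?_, fun a m => ?_, fun W h' m => ?_⟩
            · simp only [f1, map_add]
            · simp only [f2, map_smul]
            · simp only [f3, app_res]⟩
          map_add' := fun f f' => Subtype.ext (funext fun V => funext fun m =>
            map_add (app g V.1) _ _)
          map_smul' := fun c f => Subtype.ext (funext fun V => funext fun m =>
            (app g V.1).map_smul _ _) }
      naturality := fun _ _ _ => rfl }⟩

instance : (homSheaf k A M).Additive where
  map_add := rfl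

end HomSheaf

section Derived

variable {K : Type w} [CommRing K] (k : Type u) [CommRing k] [Algebra k K] {X Y : TopCat.{u}}

instance (R : RingSheaf X) : HasDerivedCategory (SheafOfModules.{u} R) :=
  HasDerivedCategory.standard _

instance : HasDerivedCategory (KSheaf k X) := HasDerivedCategory.standard _

/-- The derived sheaf of homomorphisms `RHom_A(M, N)` of two sheaves of `A`-modules, an object of
the bounded below derived category of sheaves of `k`-modules. -/
def RHom (A : AlgSheaf K X) (M N : SheafOfModules.{u} A.toRing) :
    DerivedCategory.Plus (KSheaf k X) :=
  (homSheaf k A M).rightDerivedFunctorPlus.obj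
    ((DerivedCategory.Plus.singleFunctor (SheafOfModules.{u} A.toRing) 0).obj N)

/-- The direct image of sheaves of `k`-modules. -/
abbrev pushK (f : X ⟶ Y) : KSheaf k X ⥤ KSheaf k Y :=
  (Opens.map f).sheafPushforwardContinuous (ModuleCat.{u} k) (Opens.grothendieckTopology Y)
    (Opens.grothendieckTopology X)

instance (f : X ⟶ Y) : (pushK k f).Additive where
  map_add := rfl

/-- The derived direct image `Rf_*` of sheaves of `k`-modules. -/
def RPush (f : X ⟶ Y) : DerivedCategory.Plus (KSheaf k X) ⥤ DerivedCategory.Plus (KSheaf k Y) :=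
  (pushK k f).rightDerivedFunctorPlus

end Derived

/-! ### Coherent modules and exact sequences -/

section Coherence

variable {X : TopCat.{u}} {R : RingSheaf X}

/-- On `U`, the sections `s i` generate the sheaf of modules `M`. -/
def Generates (M : SheafOfModules.{u} R) (U : Opens X) {n : ℕ} (s : Fin n → Sec M U) : Prop :=
  ∀ (V : Opens X) (hV : V ≤ U) (m : Sec M V), ∀ x ∈ V,
    ∃ (W : Opens X) (hW : W ≤ V) (a : Fin n → RSec R W),
      x ∈ W ∧ res M hW m = ∑ i, a i • res M (hW.trans hV) (s i)

/-- On `U`, the sheaf of (left) relations between the sections `s i` of `M` is generated by the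
rows of `r`. -/
def GeneratesRelations (M : SheafOfModules.{u} R) (U : Opens X) {n p : ℕ} (s : Fin n → Sec M U)
    (r : Fin p → Fin n → RSec R U) : Prop :=
  (∀ j, ∑ i, r j i • s i = 0) ∧
  ∀ (V : Opens X) (hV : V ≤ U) (a : Fin n → RSec R V), ∑ i, a i • res M hV (s i) = 0 →
    ∀ x ∈ V, ∃ (W : Opens X) (hW : W ≤ V) (b : Fin p → RSec R W),
      x ∈ W ∧ ∀ i, rres R hW (a i) = ∑ j, b j * rres R (hW.trans hV) (r j i)

/-- The sheaf of left modules `M` is coherent on the open subset `U`: it is locally finitely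
generated, and so is the sheaf of relations between any finite family of local sections. -/
structure IsCoherentOn (M : SheafOfModules.{u} R) (U : Opens X) : Prop where
  finite_type : ∀ x ∈ U, ∃ (W : Opens X) (n : ℕ) (s : Fin n → Sec M W),
    x ∈ W ∧ W ≤ U ∧ Generates M W s
  finite_relations : ∀ (W : Opens X), W ≤ U → ∀ (n : ℕ) (s : Fin n → Sec M W), ∀ x ∈ W,
    ∃ (W' : Opens X) (hW' : W' ≤ W) (p : ℕ) (r : Fin p → Fin n → RSec R W'),
      x ∈ W' ∧ GeneratesRelations M W' (fun i => res M hW' (s i)) r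

/-- Coherent sheaves of modules. -/
def IsCoherent (M : SheafOfModules.{u} R) : Prop := IsCoherentOn M ⊤

/-- `0 ⟶ M' ⟶ M ⟶ M'' ⟶ 0` is an exact sequence of sheaves on the open subset `U`. -/
structure ShortExactOn {M' M M'' : SheafOfModules.{u} R} (f : M' ⟶ M) (g : M ⟶ M'')
    (U : Opens X) : Prop where
  injective : ∀ (V : Opens X), V ≤ U → Function.Injective (app f V)
  comp_eq_zero : ∀ (V : Opens X), V ≤ U → ∀ m : Sec M' V, app g V (app f V m) = 0
  exact : ∀ (V : Opens X), V ≤ U → ∀ m : Sec M V, app g V m = 0 → ∀ x ∈ V,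
    ∃ (W : Opens X) (hW : W ≤ V) (m' : Sec M' W), x ∈ W ∧ app f W m' = res M hW m
  surjective : ∀ (V : Opens X), V ≤ U → ∀ m : Sec M'' V, ∀ x ∈ V,
    ∃ (W : Opens X) (hW : W ≤ V) (m' : Sec M W), x ∈ W ∧ app g W m' = res M'' hW m

end Coherence

/-! ### Holomorphic functions, star products and DQ-algebras -/

section Star

variable (E : Type*) [NormedAddCommGroup E] [NormedSpace ℂ E] {X : TopCat.{u}} [ChartedSpace E X]

/-- The ring of holomorphic functions on an open subset. -/
abbrev Hol (V : Opens X) : Type _ := C^ω⟮𝓘(ℂ, E), V; 𝓘(ℂ, ℂ), ℂ⟯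

/-- Restriction of holomorphic functions. -/
abbrev holRes {W V : Opens X} (h : W ≤ V) : Hol E V →+* Hol E W :=
  ContMDiffMap.restrictRingHom 𝓘(ℂ, E) 𝓘(ℂ, ℂ) ℂ h

variable {E}

open Classical in
/-- A function on an open subset, extended by zero. -/
def ext0 {V : Opens X} (f : Hol E V) (x : X) : ℂ := if h : x ∈ V then f ⟨x, h⟩ else 0

/-- The `j`-th derivative at `y` of the holomorphic function `f`, in the preferred chart at `x`. -/
def chartDeriv (x : X) (j : ℕ) {V : Opens X} (f : Hol E V) (y : X) : E [×j]→L[ℂ] ℂ :=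
  iteratedFDeriv ℂ j (fun z => ext0 f ((chartAt E x).symm z)) (chartAt E x y)

/-- A family of operations `P` on holomorphic functions on the open subsets of `W` is a
holomorphic bidifferential operator: locally, in charts, it is a finite sum of products of a
holomorphic coefficient with a partial derivative of `f` and a partial derivative of `g`
(the term of index `t` has orders `j t` and `l t`, and directions `v t` and `w t`). -/
def IsBidiff (W : Opens X) (P : ∀ V : Opens X, V ≤ W → Hol E V → Hol E V → Hol E V) : Prop :=
  ∀ x ∈ W, ∃ (N : Opens X) (d : ℕ) (j l : Fin d → ℕ) (v : ∀ t, Fin (j t) → E)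
    (w : ∀ t, Fin (l t) → E) (c : Fin d → Hol E N),
    x ∈ N ∧ N ≤ W ∧ (N : Set X) ⊆ (chartAt E x).source ∧
    ∀ (V : Opens X) (hV : V ≤ W) (f g : Hol E V) (y : X) (hy : y ∈ V) (hy' : y ∈ N),
      P V hV f g ⟨y, hy⟩ = ∑ t, c t ⟨y, hy'⟩ * chartDeriv x (j t) f y (v t) *
        chartDeriv x (l t) g y (w t)

/-- The product `f ⋆ g = ∑ ħ ^ i P_i(f, g)` on formal power series in `ħ` that is defined
by a sequence of biadditive operations `P_i`. -/
def starMul {B : Type*} [CommRing B] (P : ℕ → B → B → B) (a b : PowerSeries B) : PowerSeries B :=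
  PowerSeries.mk fun n => ∑ p ∈ Finset.HasAntidiagonal.antidiagonal n, ∑ q ∈ Finset.HasAntidiagonal.antidiagonal p.1,
    P p.2 (PowerSeries.coeff q.1 a) (PowerSeries.coeff q.2 b)

variable (E) in
/-- A star product on `O_W[[ħ]]`. -/
structure StarProduct (W : Opens X) where
  /-- the coefficients `P_i` -/
  coeff (i : ℕ) (V : Opens X) : V ≤ W → Hol E V → Hol E V → Hol E V
  isBidiff (i : ℕ) : IsBidiff W (coeff i)
  coeff_zero (V : Opens X) (h : V ≤ W) (f g : Hol E V) : coeff 0 V h f g = f * g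
  coeff_one_left (i : ℕ) (V : Opens X) (h : V ≤ W) (f : Hol E V) : 0 < i → coeff i V h 1 f = 0
  coeff_one_right (i : ℕ) (V : Opens X) (h : V ≤ W) (f : Hol E V) : 0 < i → coeff i V h f 1 = 0
  assoc (V : Opens X) (h : V ≤ W) (a b c : PowerSeries (Hol E V)) :
    starMul (fun i => coeff i V h) (starMul (fun i => coeff i V h) a b) c =
      starMul (fun i => coeff i V h) a (starMul (fun i => coeff i V h) b c)

/-- An isomorphism of sheaves of `ℂ[[ħ]]`-algebras on `W` between `A|_W` and a star-algebra
`(O_W[[ħ]], ⋆)`. -/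
structure StarIso (A : AlgSheaf (PowerSeries ℂ) X) {W : Opens X} (S : StarProduct E W) where
  /-- the isomorphism on sections -/
  toEquiv (V : Opens X) : V ≤ W → RSec A.toRing V ≃ₗ[PowerSeries ℂ] PowerSeries (Hol E V)
  map_mul (V : Opens X) (h : V ≤ W) (a b : RSec A.toRing V) :
    toEquiv V h (a * b) = starMul (fun i => S.coeff i V h) (toEquiv V h a) (toEquiv V h b)
  map_res (V V' : Opens X) (h : V ≤ W) (h' : V' ≤ V) (a : RSec A.toRing V) :
    toEquiv V' (h'.trans h) (rres A.toRing h' a) = PowerSeries.map (holRes E h') (toEquiv V h a)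

/-- The symbol `σ₀ : A ⟶ A / ħ A = O_X`, computed in a local isomorphism with a star-algebra. -/
def StarIso.symbol {A : AlgSheaf (PowerSeries ℂ) X} {W : Opens X} {S : StarProduct E W}
    (θ : StarIso A S) {V : Opens X} (h : V ≤ W) (a : RSec A.toRing V) : Hol E V :=
  PowerSeries.constantCoeff (θ.toEquiv V h a)

variable (E) in
/-- A DQ-algebra is a sheaf of `ℂ[[ħ]]`-algebras that is locally isomorphic to a star-algebra. -/
def IsDQAlgebra (A : AlgSheaf (PowerSeries ℂ) X) : Prop :=
  ∀ x : X, ∃ (W : Opens X) (S : StarProduct E W), x ∈ W ∧ Nonempty (StarIso A S)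

/-- The central section `ħ` of a sheaf of `ℂ[[ħ]]`-algebras. -/
abbrev hbar (A : AlgSheaf (PowerSeries ℂ) X) (V : Opens X) : RSec A.toRing V :=
  algebraMap (PowerSeries ℂ) (RSec A.toRing V) PowerSeries.X

end Star

/-! ### Symplectic geometry -/

section Symplectic

variable (E : Type*) [NormedAddCommGroup E] [NormedSpace ℂ E]
  (X : TopCat.{u}) [ChartedSpace E X]

/-- The expression in the preferred chart at `x₀` of a field of alternating forms. -/
def formInChart {E : Type*} [NormedAddCommGroup E] [NormedSpace ℂ E] {X : TopCat.{u}}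
    [ChartedSpace E X] (form : ∀ x : X, (TangentSpace 𝓘(ℂ, E) x) [⋀^Fin 2]→L[ℂ] ℂ)
    (x₀ : X) (z : E) : E [⋀^Fin 2]→L[ℂ] ℂ :=
  (form ((chartAt E x₀).symm z)).compContinuousLinearMap
    (mfderiv 𝓘(ℂ, E) 𝓘(ℂ, E) (chartAt E x₀).symm z)

/-- Holomorphic symplectic forms. -/
structure SymplecticForm where
  /-- the alternating form on each tangent space -/
  form (x : X) : (TangentSpace 𝓘(ℂ, E) x) [⋀^Fin 2]→L[ℂ] ℂ
  holomorphic (x₀ : X) : DifferentiableOn ℂ (formInChart form x₀) (chartAt E x₀).target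
  closed (x₀ : X) : ∀ z ∈ (chartAt E x₀).target, extDeriv (formInChart form x₀) z = 0
  nondegenerate (x : X) (v : TangentSpace 𝓘(ℂ, E) x) :
    (∀ w : TangentSpace 𝓘(ℂ, E) x, form x ![v, w] = 0) → v = 0

variable {E X}

/-- A subspace of a tangent space is Lagrangian: it is its own orthogonal. -/
def SymplecticForm.IsLagrangian (Ω : SymplecticForm E X) (x : X)
    (T : Submodule ℂ (TangentSpace 𝓘(ℂ, E) x)) : Prop :=
  ∀ v : TangentSpace 𝓘(ℂ, E) x, v ∈ T ↔ ∀ w ∈ T, Ω.form x ![v, w] = 0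

/-- The differential of a holomorphic function. -/
abbrev holDeriv {V : Opens X} (f : Hol E V) (x : X) : TangentSpace 𝓘(ℂ, E) x →L[ℂ] ℂ :=
  mfderiv 𝓘(ℂ, E) 𝓘(ℂ, ℂ) (ext0 f) x

/-- The symplectic manifold `(X, Ω)` is quantized by `A`: the Poisson bracket
`{σ₀ a, σ₀ b} = σ₀ (ħ⁻¹ (a b - b a))` is the Poisson bracket `{f, g} = H_f g` of `Ω`, where
`Ω (H_f, ·) = df`. -/
def SymplecticForm.IsQuantizedBy (Ω : SymplecticForm E X) (A : AlgSheaf (PowerSeries ℂ) X) :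
    Prop :=
  ∀ (W : Opens X) (S : StarProduct E W) (θ : StarIso A S) (V : Opens X) (h : V ≤ W)
    (a b c : RSec A.toRing V), a * b - b * a = hbar A V * c →
    ∀ (x : V) (v : TangentSpace 𝓘(ℂ, E) (x : X)),
      (∀ w, Ω.form x ![v, w] = holDeriv (θ.symbol h a) x w) →
      θ.symbol h c x = holDeriv (θ.symbol h b) x v

end Symplectic

/-! ### Simple modules and polarizations -/

section Polarization

variable (E : Type*) [NormedAddCommGroup E] [NormedSpace ℂ E]
  {X : TopCat.{u}} [ChartedSpace E X]

/-- The section `m` of `L` on `V` lies in the subsheaf `ħ L`. -/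
def MemHbar {A : AlgSheaf (PowerSeries ℂ) X} (L : SheafOfModules.{u} A.toRing) {V : Opens X}
    (m : Sec L V) : Prop :=
  ∀ x ∈ V, ∃ (W : Opens X) (hW : W ≤ V) (m' : Sec L W), x ∈ W ∧ res L hW m = hbar A W • m'

/-- The `A`-module `L` is simple along the closed complex submanifold `Z`: it is coherent and
supported by `Z`, `gr_ħ L = ℂ ⊗ L` (derived tensor product over `ℂ[[ħ]]`) is concentrated in
degree zero (that is, `ħ` acts injectively on `L`), and the `O_X`-module `L / ħ L` is an
invertible `O_Z`-module: near each point of `Z`, it is generated by one section `e`, whose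
annihilator in `O_X` is the ideal of the functions that vanish on `Z`. -/
structure IsSimpleAlong (A : AlgSheaf (PowerSeries ℂ) X) (L : SheafOfModules.{u} A.toRing)
    (Z : Set X) : Prop where
  coherent : IsCoherent L
  support : ∀ V : Opens X, Disjoint (V : Set X) Z → Subsingleton (Sec L V)
  torsion_free : ∀ (V : Opens X) (m : Sec L V), hbar A V • m = 0 → m = 0
  invertible : ∀ p ∈ Z, ∃ (W : Opens X) (S : StarProduct E W) (θ : StarIso A S) (e : Sec L W),
    p ∈ W ∧
    (∀ (V : Opens X) (hV : V ≤ W) (m : Sec L V), ∀ x ∈ V,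
      ∃ (V' : Opens X) (hV' : V' ≤ V) (a : RSec A.toRing V'), x ∈ V' ∧
        MemHbar L (res L hV' m - a • res L (hV'.trans hV) e)) ∧
    (∀ (V : Opens X) (hV : V ≤ W) (a : RSec A.toRing V),
      MemHbar L (a • res L hV e) ↔ ∀ x : V, (x : X) ∈ Z → θ.symbol hV a x = 0)

variable (E' : Type*) [NormedAddCommGroup E'] [NormedSpace ℂ E']
  {Λ : TopCat.{u}} [ChartedSpace E' Λ]

variable {E} in
/-- A polarization of `(X, A)`: a holomorphic fibre bundle `π : X ⟶ Λ` with Lagrangian fibres,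
a Lagrangian immersion `ι : Λ ⟶ X` that is a section of `π`, and an `A`-module simple along
`ι(Λ)`. -/
structure Polarization (Ω : SymplecticForm E X) (A : AlgSheaf (PowerSeries ℂ) X)
    (Λ : TopCat.{u}) [ChartedSpace E' Λ] where
  /-- the projection -/
  π : X ⟶ Λ
  /-- the section -/
  ι : Λ ⟶ X
  /-- the simple module -/
  L : SheafOfModules.{u} A.toRing
  holomorphic_π : MDifferentiable 𝓘(ℂ, E) 𝓘(ℂ, E') π
  locally_trivial (l : Λ) : ∃ (U : Opens Λ) (m : ℕ) (F : Type u) (_ : TopologicalSpace F)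
    (_ : ChartedSpace (EuclideanSpace ℂ (Fin m)) F)
    (_ : IsManifold 𝓘(ℂ, EuclideanSpace ℂ (Fin m)) ω F)
    (Φ : OpenPartialHomeomorph X (Λ × F)),
    l ∈ U ∧ Φ.source = π ⁻¹' U ∧ Φ.target = (U : Set Λ) ×ˢ Set.univ ∧
    (∀ x ∈ Φ.source, (Φ x).1 = π x) ∧
    MDifferentiableOn 𝓘(ℂ, E) (𝓘(ℂ, E').prod 𝓘(ℂ, EuclideanSpace ℂ (Fin m))) Φ Φ.source ∧
    MDifferentiableOn (𝓘(ℂ, E').prod 𝓘(ℂ, EuclideanSpace ℂ (Fin m))) 𝓘(ℂ, E) Φ.symm Φ.target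
  lagrangian_fibres (x : X) : Ω.IsLagrangian x (mfderiv 𝓘(ℂ, E) 𝓘(ℂ, E') π x).ker
  holomorphic_ι : MDifferentiable 𝓘(ℂ, E') 𝓘(ℂ, E) ι
  immersion_ι (l : Λ) : Function.Injective (mfderiv 𝓘(ℂ, E') 𝓘(ℂ, E) ι l)
  lagrangian_ι (l : Λ) : Ω.IsLagrangian (ι l) (mfderiv 𝓘(ℂ, E') 𝓘(ℂ, E) ι l).range
  section_ι : ι ≫ π = 𝟙 Λ
  simple : IsSimpleAlong E A L (Set.range ι)

end Polarization

/-! ### Compatibility -/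

section Compatible

variable {k : Type u} [CommRing k] [Algebra k (PowerSeries ℂ)] {X Y : TopCat.{u}}

/-- A morphism of sheaves of rings `φ : f⁻¹ R ⟶ A` is `k`-linear. -/
def IsAlgHom (f : X ⟶ Y) {R : AlgSheaf k Y} {A : AlgSheaf (PowerSeries ℂ) X}
    (φ : pullRing f R.toRing ⟶ A.toRing) : Prop :=
  ∀ (U : Opens Y) (c : k), ((adjRing f φ).hom.app (op U)).hom (algebraMap k (RSec R.toRing U) c) =
    algebraMap (PowerSeries ℂ) (RSec A.toRing ((Opens.map f).obj U)) (algebraMap k _ c)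

/-- For `φ : f⁻¹ R ⟶ A`, the extension of scalars `M ↦ A ⊗_{f⁻¹ R} f⁻¹ M` is exact on coherent
`R`-modules: over each open subset `U` of `Y`, it sends the exact sequences
`0 ⟶ M' ⟶ M ⟶ M'' ⟶ 0` of coherent modules on `U` to exact sequences on `f⁻¹ U`. -/
def ExactOnCoherent (f : X ⟶ Y) {R : RingSheaf Y} {A : RingSheaf X} (φ : pullRing f R ⟶ A) :
    Prop :=
  ∀ (U : Opens Y) (M' M M'' : SheafOfModules.{u} R) (g : M' ⟶ M) (h : M ⟶ M''),
    IsCoherentOn M' U → IsCoherentOn M U → IsCoherentOn M'' U → ShortExactOn g h U →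
    ShortExactOn ((extendScalars f φ).map g) ((extendScalars f φ).map h) ((Opens.map f).obj U)

/-- The pair `(φ, L_Λ)` is compatible with the map `π` and the `A`-module `L` of
a polarization. -/
structure IsCompatible (π : X ⟶ Y) {R : RingSheaf Y} {A : RingSheaf X}
    (φ : pullRing π R ⟶ A) (L : SheafOfModules.{u} A) (LΛ : SheafOfModules.{u} R) : Prop where
  exact : ExactOnCoherent π φ
  iso : Nonempty ((pushMod π φ).obj L ≅ LΛ)

end Compatible

end DQ

end

/-! For every `A`-module `J`, the adjunction between extension of scalars and direct image, applied
over each open subset of `Λ`, gives an isomorphism of sheaves `Hom_R(M, π_* J) ≃ π_* Hom_A(M^A, J)`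
(`homPushIso`). The theorem is the derived form of this identity at `L`, computed with an injective
resolution `J` of `L`. Instead of injective objects, the functors involved are derived with adapted
classes (`IsAdapted`, `derivedObjIso`), and `nonempty_derived_comp_iso` reduces everything to facts
about the terms of the resolution and about `L`.

On the side of `X`, `Hom_A(M^A, J)` is flabby when `J` is injective (`isFlabbyOn_homSheaf`), and
flabby sheaves are adapted to `π_*` (`isAdapted_pushK`).

On the side of `Λ`, two points are needed. The first is that `π_* J` still resolves `π_* L`. The
module `L` vanishes off the closed subset `ι(Λ)`, so it is flabby there. Modules that are flabby off
`ι(Λ)` are adapted to `π_*`: a section lifts near `ι(y)` and lifts off `ι(Λ)`, and the two lifts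
glue over the inverse image of a neighbourhood of `y` (`isAdapted_pushMod`).

The second is that `Hom_R(M, -)` may be computed on `π_* J`. Extension of scalars is exact on
coherent modules only, so `π_* J` need not be injective. But a left ideal `I` generated over an open
subset by finitely many sections of `R` is coherent there, and so is `R/I`. Hence `I^A → R^A` is
injective there, and by adjunction every morphism `I → π_* J` extends to `R`
(`hasLocalSolutions_pushMod`). This extension property, a sheaf version of the vanishing of
`Ext¹(R/I, Q)`, is stated with linear equations as `HasLocalSolutions`. Coherence of `R` passes from
one unknown to several by elimination (`HasLocalSolutions.exists_solution`). This yields stability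
under cokernels (`HasLocalSolutions.of_shortExact`) and, through local finite presentations of `M`,
exactness of `Hom_R(M, -)` (`homSheaf_shortExact`). -/

noncomputable section

/-! ### Derived functors computed with adapted classes of objects -/

namespace CochainComplex

variable {C : Type*} [Category* C] [Abelian C] (K : CochainComplex C ℤ)

/-- The sequence `0 ⟶ Zⁿ ⟶ Kⁿ ⟶ Zⁿ⁺¹ ⟶ 0` of an acyclic complex. -/
abbrev cyclesShortComplex (n : ℤ) : ShortComplex C :=
  ShortComplex.mk (K.iCycles n) (K.toCycles n (n + 1)) (by
    rw [← cancel_mono (K.iCycles (n + 1)), Category.assoc, HomologicalComplex.toCycles_i,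
      HomologicalComplex.iCycles_d, zero_comp])

/-- Exactness on the left holds for every complex; acyclicity in degree `n + 1` makes the map onto
the cycles an epimorphism. -/
lemma cyclesShortComplex_shortExact (hK : K.Acyclic) (n : ℤ) :
    (K.cyclesShortComplex n).ShortExact where
  exact := by
    apply ShortComplex.exact_of_f_is_kernel
    refine KernelFork.IsLimit.ofι' _ _ (fun {A} k hk => ⟨K.liftCycles k (n + 1) (by simp) ?_, ?_⟩)
    · rw [← HomologicalComplex.toCycles_i, reassoc_of% hk, zero_comp]
    · simp
  mono_f := by dsimp; infer_instance
  epi_g := by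
    have h := (hK (n + 1))
    rw [HomologicalComplex.exactAt_iff' K n (n + 1) (n + 1 + 1) (by simp) (by simp)] at h
    have := h.epi_toCycles
    have e := K.toCycles_cyclesIsoSc'_hom n (n + 1) (n + 1 + 1) (by simp) (by simp)
    change Epi (K.toCycles n (n + 1))
    rw [(Iso.eq_comp_inv _).2 e]
    exact epi_comp' this inferInstance

end CochainComplex

namespace CategoryTheory

variable {C D : Type*} [Category* C] [Category* D] [Abelian C] [Abelian D]

/-- The image of `a ≫ i` is that of `i`, and the kernel of `p ≫ j` is that of `p`. This splices the
images under a functor of the short exact sequences of cycles back into a complex. -/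
lemma ShortComplex.exact_comp_of_epi_of_mono {A Z B Z' E : C} (a : A ⟶ Z) (i : Z ⟶ B) (p : B ⟶ Z')
    (j : Z' ⟶ E) (w : i ≫ p = 0) (h : (ShortComplex.mk i p w).Exact) (_ : Epi a) (_ : Mono j) :
    (ShortComplex.mk (a ≫ i) (p ≫ j) (by simp [reassoc_of% w])).Exact := by
  let S : ShortComplex C := ShortComplex.mk (a ≫ i) p (by simp [w])
  have hS : S.Exact :=
    (ShortComplex.exact_iff_of_epi_of_isIso_of_mono
      ({ τ₁ := a, τ₂ := 𝟙 B, τ₃ := 𝟙 Z' } : S ⟶ ShortComplex.mk i p w)).2 h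
  exact (ShortComplex.exact_iff_of_epi_of_isIso_of_mono
      ({ τ₁ := 𝟙 A, τ₂ := 𝟙 B, τ₃ := j } : S ⟶ ShortComplex.mk (a ≫ i) (p ≫ j) _)).1 hS

/-- From the long exact homology sequence. A degree without predecessor has no connecting map into
it; there, injectivity on homology comes directly from that of `S.f`. -/
lemma ShortComplex.ShortExact.quasiIso_f {ι : Type*} {c : ComplexShape ι}
    {S : ShortComplex (HomologicalComplex C c)} (hS : S.ShortExact) (h : S.X₃.Acyclic) :
    _root_.QuasiIso S.f := by
  rw [_root_.quasiIso_iff]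
  intro i
  rw [quasiIsoAt_iff_isIso_homologyMap]
  have hz : ∀ j, IsZero (S.X₃.homology j) := fun j => by
    rw [← HomologicalComplex.exactAt_iff_isZero_homology]; exact h j
  have : Epi (HomologicalComplex.homologyMap S.f i) :=
    (hS.homology_exact₂ i).epi_f ((hz i).eq_of_tgt _ _)
  have : Mono (HomologicalComplex.homologyMap S.f i) := by
    by_cases! hi : ∃ j, c.Rel j i
    · obtain ⟨j, hj⟩ := hi
      exact (hS.homology_exact₁ j i hj).mono_g ((hz j).eq_of_src _ _)
    · have := hS.mono_f
      exact HomologicalComplex.mono_homologyMap_of_mono_of_not_rel S.f i hi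
  exact isIso_of_mono_of_epi _

namespace Functor

/-- A class of objects that is adapted to an additive functor `F`: it contains the injective
objects, it is stable under cokernels of monomorphisms, and `F` is exact on short exact sequences
whose first term is in the class. -/
structure IsAdapted (F : C ⥤ D) [F.Additive] (P : ObjectProperty C) : Prop where
  of_injective (I : C) : Injective I → P I
  of_shortExact (S : ShortComplex C) : S.ShortExact → P S.X₁ → P S.X₂ → P S.X₃
  map_shortExact (S : ShortComplex C) : S.ShortExact → P S.X₁ → (S.map F).ShortExact

namespace IsAdapted

variable {F : C ⥤ D} [F.Additive] {P : ObjectProperty C} (hP : F.IsAdapted P)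

include hP

/-- In an acyclic complex `Zⁿ⁺¹` is the cokernel of `Zⁿ → Kⁿ`, so membership propagates upwards from
the degrees where the complex vanishes. -/
lemma cycles_mem (K : CochainComplex C ℤ) (hK : K.Acyclic) (n₀ : ℤ) [K.IsStrictlyGE n₀]
    (hKP : ∀ n, P (K.X n)) (n : ℤ) : P (K.cycles n) := by
  have low : ∀ n < n₀, P (K.cycles n) := fun n hn =>
    hP.of_injective _ (IsZero.of_mono (K.iCycles n) (K.isZero_of_isStrictlyGE n₀ n hn)).injective
  by_cases hn : n < n₀
  · exact low n hn
  -- The induction starts at `n₀ - 1`, where the cycles are zero, hence injective.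
  · obtain ⟨m, rfl⟩ : ∃ m : ℕ, n = n₀ - 1 + m := ⟨(n - (n₀ - 1)).toNat, by lia⟩
    clear hn
    induction m with
    | zero => exact low _ (by simp)
    | succ m ih =>
      have := hP.of_shortExact _ (K.cyclesShortComplex_shortExact hK (n₀ - 1 + m)) ih (hKP _)
      have e : n₀ - 1 + ((m + 1 : ℕ) : ℤ) = n₀ - 1 + m + 1 := by push_cast; ring
      rw [e]
      exact this

/-- The sequences `0 → Zⁿ → Kⁿ → Zⁿ⁺¹ → 0` stay exact under `F` because the cycles are in the class;
three consecutive ones give exactness at the middle degree. -/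
lemma map_acyclic (K : CochainComplex C ℤ) (hK : K.Acyclic) (n₀ : ℤ) [K.IsStrictlyGE n₀]
    (hKP : ∀ n, P (K.X n)) : ((F.mapHomologicalComplex (.up ℤ)).obj K).Acyclic := by
  intro n
  obtain ⟨m, rfl⟩ : ∃ m, n = m + 1 := ⟨n - 1, by simp⟩
  rw [HomologicalComplex.exactAt_iff' _ m (m + 1) (m + 1 + 1) (by simp) (by simp)]
  have h₁ := hP.map_shortExact _ (K.cyclesShortComplex_shortExact hK m)
    (hP.cycles_mem K hK n₀ hKP _)
  have h₂ := hP.map_shortExact _ (K.cyclesShortComplex_shortExact hK (m + 1))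
    (hP.cycles_mem K hK n₀ hKP _)
  have h₃ := hP.map_shortExact _ (K.cyclesShortComplex_shortExact hK (m + 1 + 1))
    (hP.cycles_mem K hK n₀ hKP _)
  have key := ShortComplex.exact_comp_of_epi_of_mono (F.map (K.toCycles m (m + 1))) _ _
    (F.map (K.iCycles (m + 1 + 1))) _ h₂.exact h₁.epi_g h₃.mono_f
  refine Eq.mp ?_ key
  congr 1
  · congr 1
    · exact (F.map_comp _ _).symm.trans (congrArg F.map (K.toCycles_i _ _))
    · exact (F.map_comp _ _).symm.trans (congrArg F.map (K.toCycles_i _ _))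

/-- The cokernel of `f` is an acyclic complex with terms in the class, so `F` keeps it acyclic; and
`F` keeps the sequence of `f` and its cokernel exact degree by degree. -/
lemma map_quasiIso_of_mono {K L : CochainComplex C ℤ} (f : K ⟶ L) [Mono f] [QuasiIso f] (n₀ : ℤ)
    [K.IsStrictlyGE n₀] [L.IsStrictlyGE n₀] (hK : ∀ n, P (K.X n)) (hL : ∀ n, P (L.X n)) :
    QuasiIso ((F.mapHomologicalComplex (.up ℤ)).map f) := by
  let S : ShortComplex (CochainComplex C ℤ) := ShortComplex.mk f (cokernel.π f) (by simp)
  have hS : S.ShortExact := ⟨ShortComplex.exact_cokernel f⟩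
  have hdeg := (HomologicalComplex.shortExact_iff_degreewise_shortExact S).1 hS
  have hC : ∀ n, P (S.X₃.X n) := fun n => hP.of_shortExact _ (hdeg n) (hK n) (hL n)
  have : S.X₃.IsStrictlyGE n₀ := by
    rw [CochainComplex.isStrictlyGE_iff]
    intro i hi
    exact @IsZero.of_epi _ _ _ _ _ ((S.map (HomologicalComplex.eval C _ i)).g) (hdeg i).epi_g
      (L.isZero_of_isStrictlyGE n₀ i hi)
  have hFS : (S.map (F.mapHomologicalComplex (.up ℤ))).ShortExact := by
    rw [HomologicalComplex.shortExact_iff_degreewise_shortExact]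
    intro i
    exact hP.map_shortExact _ (hdeg i) (hK i)
  exact hFS.quasiIso_f (hP.map_acyclic S.X₃ (hS.acyclic_X₃ ‹_›) n₀ hC)

variable [EnoughInjectives C] [HasDerivedCategory C] [HasDerivedCategory D]

/-- The unit is invertible at a complex `L` of injective objects. A monomorphic quasi-isomorphism `K
⟶ L` remains a quasi-isomorphism under `F`, so naturality carries invertibility from `L` back to
`K`. -/
lemma isIso_unit_app (K : CochainComplex.Plus C) (hK : ∀ n, P (K.obj.X n)) :
    IsIso (F.rightDerivedFunctorPlusUnit.app ((HomotopyCategory.Plus.quotient C).obj K)) := by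
  obtain ⟨K, n, hn⟩ := K
  -- The resolution is only bounded below by `n - 1`, so both complexes are regarded with this
  -- weaker bound.
  obtain ⟨L, i, hi, hi', hL, hL'⟩ := CochainComplex.Plus.modelCategoryQuillen.exists_mono_quasiIso_injective K (n - 1) n
  have : K.IsStrictlyGE (n - 1) := K.isStrictlyGE_of_ge (n - 1) n (by lia)
  have hq := hP.map_quasiIso_of_mono i (n - 1) hK (fun n => hP.of_injective _ (hL n))
  let L' : CochainComplex.Plus C := ⟨L, n - 1, hL'⟩
  let i' : (⟨K, n, hn⟩ : CochainComplex.Plus C) ⟶ L' := ObjectProperty.homMk i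
  have hinj : IsIso (F.rightDerivedFunctorPlusUnit.app
      ((HomotopyCategory.Plus.quotient C).obj L')) := by
    have (n : ℤ) : Injective (((HomotopyCategory.Plus.quotient C).obj L').obj.as.X n) := hL n
    infer_instance
  have nat := F.rightDerivedFunctorPlusUnit.naturality ((HomotopyCategory.Plus.quotient C).map i')
  have h₁ : IsIso ((F.mapHomotopyCategoryPlus ⋙ DerivedCategory.Plus.Qh).map
      ((HomotopyCategory.Plus.quotient C).map i')) := by
    apply Localization.inverts DerivedCategory.Plus.Qh (HomotopyCategory.Plus.quasiIso D)
    exact (HomotopyCategory.quotient_map_mem_quasiIso_iff _).2 hq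
  have h₂ : IsIso ((DerivedCategory.Plus.Qh ⋙ F.rightDerivedFunctorPlus).map
      ((HomotopyCategory.Plus.quotient C).map i')) := by
    have := Localization.inverts DerivedCategory.Plus.Qh (HomotopyCategory.Plus.quasiIso C)
      ((HomotopyCategory.Plus.quotient C).map i')
      ((HomotopyCategory.quotient_map_mem_quasiIso_iff _).2 hi')
    dsimp only [Functor.comp_map]
    infer_instance
  have : IsIso (F.rightDerivedFunctorPlusUnit.app
      ((HomotopyCategory.Plus.quotient C).obj ⟨K, n, hn⟩) ≫
      (DerivedCategory.Plus.Qh ⋙ F.rightDerivedFunctorPlus).map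
      ((HomotopyCategory.Plus.quotient C).map i')) := by
    rw [← nat]; infer_instance
  exact IsIso.of_isIso_comp_right _ ((DerivedCategory.Plus.Qh ⋙ F.rightDerivedFunctorPlus).map
      ((HomotopyCategory.Plus.quotient C).map i'))

/-- Right derived functors can be computed with complexes of objects of an adapted class. -/
def derivedObjIso (K : CochainComplex.Plus C) (hK : ∀ n, P (K.obj.X n)) :
    DerivedCategory.Plus.Q.obj (F.mapCochainComplexPlus.obj K) ≅
      F.rightDerivedFunctorPlus.obj (DerivedCategory.Plus.Q.obj K) :=
  @asIso _ _ _ _ (F.rightDerivedFunctorPlusUnit.app ((HomotopyCategory.Plus.quotient C).obj K))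
    (hP.isIso_unit_app K hK)

end IsAdapted
end Functor
end CategoryTheory

/-! ### Exact sequences of sheaves of modules, on sections -/

namespace DQ

section SectionsOfExactSequences

variable {X : TopCat.{u}} {R : RingSheaf X}

lemma app_comp {M N P : SheafOfModules.{u} R} (f : M ⟶ N) (g : N ⟶ P) (U : Opens X)
    (m : Sec M U) : app (f ≫ g) U m = app g U (app f U m) := rfl

lemma app_injective {M N : SheafOfModules.{u} R} (f : M ⟶ N) [Mono f] (U : Opens X) :
    Function.Injective (app f U) := by
  have : Mono ((SheafOfModules.evaluation R (op U)).map f) := inferInstance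
  exact (ModuleCat.mono_iff_injective _).1 this

instance (U : (Opens X)ᵒᵖ) : (SheafOfModules.evaluation.{u} R U).Additive where
  map_add := rfl

lemma app_exact {S : ShortComplex (SheafOfModules.{u} R)} (hS : S.ShortExact) (U : Opens X)
    (m : Sec S.X₂ U) (hm : app S.g U m = 0) : ∃ m' : Sec S.X₁ U, app S.f U m' = m := by
  have h := hS.exact.map_of_mono_of_preservesKernel (SheafOfModules.evaluation R (op U)) hS.mono_f
    inferInstance
  rw [ShortComplex.moduleCat_exact_iff] at h
  exact h m hm

/-- The presheaf cokernel of an epimorphism of sheaves has zero image in its sheafification, so each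
of its sections is locally zero. Presheaf cokernels are computed open subset by open subset, so a
section whose class vanishes on `W` lifts on `W`. -/
lemma app_locally_surjective {M N : SheafOfModules.{u} R} (g : M ⟶ N) [Epi g] (U : Opens X)
    (n : Sec N U) (x : X) (hx : x ∈ U) :
    ∃ (W : Opens X) (hW : W ≤ U) (m : Sec M W), x ∈ W ∧ app g W m = res N hW n := by
  let adj := PresheafOfModules.sheafificationAdjunction (𝟙 R.obj)
  let F := PresheafOfModules.sheafification.{u} (𝟙 R.obj)
  let G := SheafOfModules.forget R ⋙ PresheafOfModules.restrictScalars (𝟙 R.obj)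
  let g' := G.map g
  let c := cokernel.π g'
  have nat := adj.counit.naturality g
  -- Sheafifying the presheaf map underlying `g` gives back `g` up to the counit isomorphisms.
  have h1 : Epi (F.map g') := by
    have : F.map g' = adj.counit.app M ≫ g ≫ inv (adj.counit.app N) := by
      rw [← reassoc_of% nat]; simp [F, g', G]
    rw [this]; infer_instance
  have h2 : F.map c = 0 := by
    rw [← cancel_epi (F.map g'), ← F.map_comp, cokernel.condition, F.map_zero, comp_zero]
  have hu : c ≫ adj.unit.app (cokernel g') = 0 := by
    refine (adj.unit.naturality c).trans ?_
    change adj.unit.app _ ≫ G.map (F.map c) = 0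
    rw [h2, G.map_zero, comp_zero]
  have hz : ((adj.unit.app (cokernel g')).app (op U)).hom ((c.app (op U)).hom n) = 0 :=
    congrArg (fun f => (f.app (op U)).hom n) hu
  have hloc := Presheaf.equalizerSieve_mem (Opens.grothendieckTopology X)
    (toSheafify (Opens.grothendieckTopology X) (cokernel g').presheaf)
    (X := op U) ((c.app (op U)).hom n) 0 (hz.trans (map_zero _).symm)
  obtain ⟨W, i, hi, hxW⟩ := hloc x hx
  have hexact : (ShortComplex.mk g' c (cokernel.condition g')).Exact :=
    ShortComplex.exact_cokernel g'
  have h := hexact.map (PresheafOfModules.evaluation R.obj (op W))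
  rw [ShortComplex.moduleCat_exact_iff] at h
  obtain ⟨m, hm⟩ := h (res N i.le n) (by
    have h3 := PresheafOfModules.naturality_apply c i.op n
    have h4 : ((cokernel g').map i.op).hom ((c.app (op U)).hom n) = 0 := hi.trans (map_zero _)
    exact h3.trans h4)
  exact ⟨W, i.le, m, hxW, hm⟩

lemma epi_of_locally_surjective {M N : SheafOfModules.{u} R} (g : M ⟶ N)
    (h : ∀ (U : Opens X) (n : Sec N U), ∀ x ∈ U,
      ∃ (W : Opens X) (hW : W ≤ U) (m : Sec M W), x ∈ W ∧ app g W m = res N hW n) : Epi g := by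
  constructor
  intro P a b hab
  apply SheafOfModules.hom_ext
  apply PresheafOfModules.hom_ext
  rintro ⟨U⟩
  ext n
  choose W hW m hxW hm using fun x : U => h U n x x.2
  refine sec_ext (M := P) W U hW (fun x hx => Opens.mem_iSup.2 ⟨⟨x, hx⟩, hxW _⟩) _ _ (fun x => ?_)
  have ha := app_res a (hW x) n
  have hb := app_res b (hW x) n
  refine ha.symm.trans (Eq.trans ?_ hb)
  rw [← hm, ← app_comp, ← app_comp, hab]

end SectionsOfExactSequences

/-! ### Exact sequences of sheaves of `k`-modules -/

section KSheaves

variable {k : Type u} [CommRing k] {X : TopCat.{u}}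

lemma kSheaf_epi_iff {F G : KSheaf k X} (g : F ⟶ G) :
    Epi g ↔ ∀ (U : Opens X) (t : G.obj.obj (op U)), ∀ x ∈ U, ∃ (V : Opens X) (h : V ≤ U)
      (s : F.obj.obj (op V)), x ∈ V ∧ (g.hom.app (op V)).hom s = (G.obj.map (homOfLE h).op).hom t := by
  refine (TopCat.Sheaf.isLocallySurjective_iff_epi (X := X) (C := ModuleCat.{u} k) g).symm.trans ?_
  rw [TopCat.Presheaf.isLocallySurjective_iff]
  constructor
  · intro h U t x hx
    obtain ⟨V, hV, ⟨s, hs⟩, hx⟩ := h U t x hx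
    exact ⟨V, hV, s, hx, hs⟩
  · intro h U t x hx
    obtain ⟨V, hV, s, hx, hs⟩ := h U t x hx
    exact ⟨V, hV, ⟨s, hs⟩, hx⟩

lemma kSheaf_app_injective {F G : KSheaf k X} (f : F ⟶ G) [Mono f] (U : Opens X) :
    Function.Injective (f.hom.app (op U)).hom := by
  have : Mono ((sheafToPresheaf _ _ ⋙ (evaluation _ _).obj (op U)).map f) := inferInstance
  exact (ModuleCat.mono_iff_injective _).1 this

lemma kSheaf_mono_of_injective {F G : KSheaf k X} (f : F ⟶ G)
    (h : ∀ U : Opens X, Function.Injective (f.hom.app (op U)).hom) : Mono f := by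
  have : Mono ((sheafToPresheaf _ _).map f) := by
    rw [NatTrans.mono_iff_mono_app]
    rintro ⟨U⟩
    exact (ModuleCat.mono_iff_injective _).2 (h U)
  exact (sheafToPresheaf _ _).mono_of_mono_map this

/-- A practical criterion: injectivity and middle exactness are checked on sections, surjectivity
only locally. Middle exactness becomes surjectivity onto the kernel, whose sections embed in those
of the middle term. -/
lemma kSheaf_shortExact {S : ShortComplex (KSheaf k X)}
    (h₁ : ∀ U : Opens X, Function.Injective (S.f.hom.app (op U)).hom)
    (h₂ : ∀ (U : Opens X) (s : S.X₂.obj.obj (op U)), (S.g.hom.app (op U)).hom s = 0 →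
      ∃ s' : S.X₁.obj.obj (op U), (S.f.hom.app (op U)).hom s' = s)
    (h₃ : ∀ (U : Opens X) (t : S.X₃.obj.obj (op U)), ∀ x ∈ U, ∃ (V : Opens X) (h : V ≤ U)
      (s : S.X₂.obj.obj (op V)), x ∈ V ∧
        (S.g.hom.app (op V)).hom s = (S.X₃.obj.map (homOfLE h).op).hom t) :
    S.ShortExact where
  epi_g := (kSheaf_epi_iff _).2 h₃
  mono_f := kSheaf_mono_of_injective _ h₁
  exact := by
    rw [ShortComplex.exact_iff_epi_kernel_lift, kSheaf_epi_iff]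
    intro U t x hx
    have ht : (S.g.hom.app (op U)).hom (((kernel.ι S.g).hom.app (op U)).hom t) = 0 :=
      congrArg (fun f => (f.hom.app (op U)).hom t) (kernel.condition S.g)
    obtain ⟨s, hs⟩ := h₂ U _ ht
    refine ⟨U, le_rfl, s, hx, kSheaf_app_injective (kernel.ι S.g) U ?_⟩
    have e : ((kernel.ι S.g).hom.app (op U)).hom
        (((kernel.lift S.g S.f S.zero).hom.app (op U)).hom s) = (S.f.hom.app (op U)).hom s :=
      congrArg (fun f => (f.hom.app (op U)).hom s) (kernel.lift_ι S.g S.f S.zero)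
    rw [e, hs]
    have h := ConcreteCategory.congr_hom ((kernel S.g).obj.map_id (op U)) t
    exact (congrArg _ h).symm

lemma kSheaf_app_exact {S : ShortComplex (KSheaf k X)} (hS : S.ShortExact) (U : Opens X)
    (m : S.X₂.obj.obj (op U)) (hm : (S.g.hom.app (op U)).hom m = 0) :
    ∃ m' : S.X₁.obj.obj (op U), (S.f.hom.app (op U)).hom m' = m := by
  have h := hS.exact.map_of_mono_of_preservesKernel
    (sheafToPresheaf _ _ ⋙ (evaluation _ _).obj (op U)) hS.mono_f inferInstance
  rw [ShortComplex.moduleCat_exact_iff] at h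
  exact h m hm

end KSheaves

/-! ### Flabby sheaves on an open subset -/

section Flabby

variable {X : TopCat.{u}}

/-- The category of sheaves of abelian groups on a space. -/
abbrev AbSheaf (X : TopCat.{u}) := CategoryTheory.Sheaf (Opens.grothendieckTopology X) Ab.{u}

/-- Restriction of sections of a sheaf of abelian groups. -/
abbrev ares (F : AbSheaf X) {V U : Opens X} (h : V ≤ U) :
    F.obj.obj (op U) →+ F.obj.obj (op V) := (F.obj.map (homOfLE h).op).hom

lemma ares_ares (F : AbSheaf X) {W V U : Opens X} (h : W ≤ V) (h' : V ≤ U)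
    (s : F.obj.obj (op U)) : ares F h (ares F h' s) = ares F (h.trans h') s := by
  have := ConcreteCategory.congr_hom (F.obj.map_comp (homOfLE h').op (homOfLE h).op) s
  exact this.symm

lemma ares_self (F : AbSheaf X) {U : Opens X} (s : F.obj.obj (op U)) : ares F le_rfl s = s :=
  ConcreteCategory.congr_hom (F.obj.map_id (op U)) s

lemma abSheaf_app_ares {F G : AbSheaf X} (f : F ⟶ G) {V U : Opens X} (h : V ≤ U)
    (s : F.obj.obj (op U)) :
    (f.hom.app (op V)).hom (ares F h s) = ares G h ((f.hom.app (op U)).hom s) :=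
  ConcreteCategory.congr_hom (f.hom.naturality (homOfLE h).op) s

/-- The sheaf `F` is flabby on `O`: sections extend from open subsets of `O` to larger ones. -/
def IsFlabbyOn (F : AbSheaf X) (O : Opens X) : Prop :=
  ∀ (V U : Opens X) (h : V ≤ U), U ≤ O → Function.Surjective (ares F h)

lemma ares_glue (F : AbSheaf X) {ι : Type u} (U : ι → Opens X) (V : Opens X) (hU : ∀ i, U i ≤ V)
    (hV : V ≤ iSup U) (s : ∀ i, F.obj.obj (op (U i)))
    (hs : ∀ i j (W : Opens X) (hi : W ≤ U i) (hj : W ≤ U j),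
      ares F hi (s i) = ares F hj (s j)) :
    ∃ t : F.obj.obj (op V), ∀ i, ares F (hU i) t = s i := by
  obtain ⟨t, ht, -⟩ := TopCat.Sheaf.existsUnique_gluing' (X := X) F U V (fun i => homOfLE (hU i))
    hV s (fun i j => hs i j (U i ⊓ U j) inf_le_left inf_le_right)
  exact ⟨t, ht⟩

lemma ares_ext (F : AbSheaf X) {ι : Type u} (U : ι → Opens X) (V : Opens X) (hU : ∀ i, U i ≤ V)
    (hV : V ≤ iSup U) (s t : F.obj.obj (op V)) (h : ∀ i, ares F (hU i) s = ares F (hU i) t) :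
    s = t :=
  TopCat.Sheaf.eq_of_locally_eq' (X := X) F U V (fun i => homOfLE (hU i)) hV s t h

lemma ares_glue_two (F : AbSheaf X) (U₁ U₂ : Opens X) (s₁ : F.obj.obj (op U₁))
    (s₂ : F.obj.obj (op U₂))
    (h : ares F (inf_le_left : U₁ ⊓ U₂ ≤ U₁) s₁ = ares F inf_le_right s₂) :
    ∃ t : F.obj.obj (op (U₁ ⊔ U₂)), ares F le_sup_left t = s₁ ∧ ares F le_sup_right t = s₂ := by
  let U : ULift.{u} Bool → Opens X := fun b => bif b.down then U₁ else U₂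
  let s : ∀ b, F.obj.obj (op (U b))
    | ⟨true⟩ => s₁
    | ⟨false⟩ => s₂
  have key : ∀ (W : Opens X) (h₁ : W ≤ U₁) (h₂ : W ≤ U₂), ares F h₁ s₁ = ares F h₂ s₂ := by
    intro W h₁ h₂
    have := congrArg (ares F (le_inf h₁ h₂)) h
    rwa [ares_ares, ares_ares] at this
  obtain ⟨t, ht⟩ := ares_glue F U (U₁ ⊔ U₂)
    (by rintro ⟨_ | _⟩; exacts [le_sup_right, le_sup_left])
    (sup_le (le_iSup U ⟨true⟩) (le_iSup U ⟨false⟩)) s (by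
      rintro ⟨_ | _⟩ ⟨_ | _⟩ W hi hj
      · rfl
      · exact (key W hj hi).symm
      · exact key W hi hj
      · rfl)
  exact ⟨t, ht ⟨true⟩, ht ⟨false⟩⟩

lemma ares_ext_two (F : AbSheaf X) (U₁ U₂ : Opens X) (s t : F.obj.obj (op (U₁ ⊔ U₂)))
    (h₁ : ares F le_sup_left s = ares F le_sup_left t)
    (h₂ : ares F le_sup_right s = ares F le_sup_right t) : s = t := by
  let U : ULift.{u} Bool → Opens X := fun b => bif b.down then U₁ else U₂
  refine ares_ext F U (U₁ ⊔ U₂) (by rintro ⟨_ | _⟩; exacts [le_sup_right, le_sup_left])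
    (sup_le (le_iSup U ⟨true⟩) (le_iSup U ⟨false⟩)) s t ?_
  rintro ⟨_ | _⟩
  exacts [h₂, h₁]

/-- The sequence `F ⟶ G ⟶ H` of sheaves of abelian groups is exact in the middle on sections, and
its second map is locally surjective. -/
structure IsSectionwiseExact {F G H : AbSheaf X} (f : F ⟶ G) (g : G ⟶ H) : Prop where
  comp_eq_zero (U : Opens X) (s : F.obj.obj (op U)) :
    (g.hom.app (op U)).hom ((f.hom.app (op U)).hom s) = 0
  exact (U : Opens X) (s : G.obj.obj (op U)) : (g.hom.app (op U)).hom s = 0 →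
    ∃ s' : F.obj.obj (op U), (f.hom.app (op U)).hom s' = s
  locally_surjective (U : Opens X) (t : H.obj.obj (op U)) : ∀ x ∈ U, ∃ (V : Opens X) (h : V ≤ U)
      (s : G.obj.obj (op V)), x ∈ V ∧ (g.hom.app (op V)).hom s = ares H h t

namespace IsSectionwiseExact

variable {F G H : AbSheaf X} {f : F ⟶ G} {g : G ⟶ H} (hfg : IsSectionwiseExact f g)

include hfg

/-- Two local liftings of a section can be glued, if the sections of `F` on the intersection
extend to one of the two open subsets. -/
lemma glue_lifts {U V W : Opens X} (hV : V ≤ U) (hW : W ≤ U) (t : H.obj.obj (op U))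
    (s : G.obj.obj (op V)) (hs : (g.hom.app (op V)).hom s = ares H hV t)
    (s' : G.obj.obj (op W)) (hs' : (g.hom.app (op W)).hom s' = ares H hW t)
    (hF : Function.Surjective (ares F (inf_le_right : V ⊓ W ≤ W))) :
    ∃ r : G.obj.obj (op (V ⊔ W)), ares G le_sup_left r = s ∧
      (g.hom.app (op (V ⊔ W))).hom r = ares H (sup_le hV hW) t := by
  obtain ⟨d, hd⟩ := hfg.exact (V ⊓ W) (ares G inf_le_left s - ares G inf_le_right s') (by
    rw [map_sub, abSheaf_app_ares, abSheaf_app_ares, hs, hs', ares_ares, ares_ares, sub_self])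
  -- The difference of the two lifts comes from `F` on `V ⊓ W`; extended to `W`, it corrects `s'` so
  -- that it agrees with `s` on the overlap.
  obtain ⟨e, rfl⟩ := hF d
  obtain ⟨r, hr₁, hr₂⟩ := ares_glue_two G V W s (s' + (f.hom.app (op W)).hom e) (by
    rw [map_add, ← abSheaf_app_ares, hd]; abel)
  refine ⟨r, hr₁, ares_ext_two H V W _ _ ?_ ?_⟩
  · rw [← abSheaf_app_ares, hr₁, hs, ares_ares]
  · rw [← abSheaf_app_ares, hr₂, map_add, hfg.comp_eq_zero, add_zero, hs', ares_ares]

/-- Zorn's lemma on the pairs of an open subset of `U` and a lift of `t` over it: chains have bounds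
by gluing, and `glue_lifts` enlarges any lift that is not yet defined near some point. -/
lemma surjective_of_isFlabbyOn {O : Opens X} (hF : IsFlabbyOn F O) {U : Opens X} (hU : U ≤ O) :
    Function.Surjective (g.hom.app (op U)).hom := by
  intro t
  let S := {p : Σ V : Opens X, G.obj.obj (op V) //
    ∃ h : p.1 ≤ U, (g.hom.app (op p.1)).hom p.2 = ares H h t}
  let r : S → S → Prop := fun p q => ∃ h : p.1.1 ≤ q.1.1, ares G h q.1.2 = p.1.2
  have rtrans : ∀ {a b c : S}, r a b → r b c → r a c := by
    rintro a b c ⟨h, e⟩ ⟨h', e'⟩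
    exact ⟨h.trans h', by rw [← ares_ares G h h', e', e]⟩
  obtain ⟨⟨⟨V, s⟩, hV, hs⟩, hmax⟩ := exists_maximal_of_chains_bounded (r := r) (by
    intro c hc
    let f' : c → Opens X := fun p => p.1.1.1
    have hle : iSup f' ≤ U := iSup_le fun p => p.1.2.1
    have comp : ∀ (i j : c) (W : Opens X) (hi : W ≤ f' i) (hj : W ≤ f' j),
        ares G hi i.1.1.2 = ares G hj j.1.1.2 := by
      intro i j W hi hj
      by_cases hij : i = j
      · subst hij; rfl
      · obtain ⟨h, e⟩ | ⟨h, e⟩ := hc i.2 j.2 (fun e => hij (Subtype.ext e))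
        · rw [← e, ares_ares]
        · rw [← e, ares_ares]
    obtain ⟨s, hs⟩ := ares_glue G f' (iSup f') (le_iSup f') le_rfl (fun p => p.1.1.2) comp
    refine ⟨⟨⟨iSup f', s⟩, hle, ares_ext H f' _ (le_iSup f') le_rfl _ _ fun i => ?_⟩,
      fun a ha => ⟨le_iSup f' ⟨a, ha⟩, hs ⟨a, ha⟩⟩⟩
    rw [← abSheaf_app_ares, hs i, ares_ares]
    exact i.1.2.2) rtrans
  have hUV : U ≤ V := by
    intro x hx
    obtain ⟨W, hW, s', hxW, hs'⟩ := hfg.locally_surjective U t x hx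
    obtain ⟨q, hq, hq'⟩ := hfg.glue_lifts hV hW t s hs s' hs' (hF _ _ _ (hW.trans hU))
    obtain ⟨h, -⟩ := hmax ⟨⟨V ⊔ W, q⟩, sup_le hV hW, hq'⟩ ⟨le_sup_left, hq⟩
    exact h (Or.inr hxW)
  refine ⟨ares G hUV s, ?_⟩
  rw [abSheaf_app_ares, hs, ares_ares, ares_self]

/-- A section of `H` lifts to `G` because `F` is flabby, and the lift extends because `G` is. -/
lemma isFlabbyOn {O : Opens X} (hF : IsFlabbyOn F O) (hG : IsFlabbyOn G O) : IsFlabbyOn H O := by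
  intro V U h hU t
  obtain ⟨s, rfl⟩ := hfg.surjective_of_isFlabbyOn hF (h.trans hU) t
  obtain ⟨s', rfl⟩ := hG V U h hU s
  exact ⟨(g.hom.app (op U)).hom s', (abSheaf_app_ares g h s').symm⟩

end IsSectionwiseExact

end Flabby

attribute [local instance] secModule

/-! ### Extension of local morphisms to injective modules -/

section Injective

variable {K : Type w} [CommRing K] {k : Type u} [CommRing k] [Algebra k K] {X : TopCat.{u}}
  {A : AlgSheaf K X}

lemma localHom_map_zero {M N : SheafOfModules.{u} A.toRing} {U : Opens X} (f : localHom k A M N U)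
    {V : Opens X} (h : V ≤ U) : f.1 ⟨V, h⟩ 0 = 0 := by
  have := (f.2 V h).1 0 0
  rw [add_zero] at this
  exact left_eq_add.1 this

open Classical in
/-- The extension by zero (as a presheaf) of the restriction of `N` to `U`. -/
def extendByZero {R : RingSheaf X} (N : SheafOfModules.{u} R) (U : Opens X) :
    N.val.Submodule where
  obj V := if V.unop ≤ U then ⊤ else ⊥
  map {V W} i := by
    by_cases h : V.unop ≤ U
    · rw [if_pos (i.unop.le.trans h)]
      exact fun _ _ => trivial
    · rw [if_neg h]
      exact bot_le

lemma eq_zero_of_mem_extendByZero {R : RingSheaf X} {N : SheafOfModules.{u} R} {U V : Opens X}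
    (h : ¬ V ≤ U) (m : (extendByZero N U).obj (op V)) : m = 0 := by
  obtain ⟨m, hm⟩ := m
  have : (extendByZero N U).obj (op V) = ⊥ := if_neg h
  rw [this] at hm
  exact Subtype.ext hm

lemma mem_extendByZero {R : RingSheaf X} {N : SheafOfModules.{u} R} {U V : Opens X}
    (h : V ≤ U) (m : Sec N V) : m ∈ (extendByZero N U).obj (op V) := by
  have : (extendByZero N U).obj (op V) = ⊤ := if_pos h
  rw [this]; trivial

/-- The inclusion of sheaves into presheaves is right adjoint to sheafification, which preserves
monomorphisms. Extension problems may thus be posed on presheaves, where extension by zero needs no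
sheafification. -/
lemma injective_val {R : RingSheaf X} (J : SheafOfModules.{u} R) [Injective J] :
    Injective J.val := by
  have h := Injective.injective_of_adjoint
    (PresheafOfModules.sheafificationAdjunction (𝟙 R.obj)) J
  exact h

open Classical in
/-- The morphism on the extension by zero that corresponds to a local morphism. -/
def extendByZeroDesc {N J : SheafOfModules.{u} A.toRing} {U : Opens X}
    (f : localHom k A N J U) : (extendByZero N U).toPresheafOfModules ⟶ J.val :=
  PresheafOfModules.homMk
    { app V := AddCommGrpCat.ofHom
        { toFun m := if h : V.unop ≤ U then f.1 ⟨V.unop, h⟩ m.1 else 0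
          map_zero' := by
            split_ifs with h
            · exact localHom_map_zero f h
            · rfl
          map_add' := fun m m' => by
            split_ifs with h
            · exact (f.2 V.unop h).1 _ _
            · exact (add_zero _).symm }
      naturality V W i := by
        ext m
        change (if h : W.unop ≤ U then f.1 ⟨W.unop, h⟩ (res N i.unop.le m.1) else 0) =
          res J i.unop.le (if h : V.unop ≤ U then f.1 ⟨V.unop, h⟩ m.1 else 0)
        by_cases h : V.unop ≤ U
        · rw [dif_pos h, dif_pos (i.unop.le.trans h)]
          exact (f.2 V.unop h).2.2 _ i.unop.le _
        · rw [dif_neg h, map_zero]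
          split_ifs with h'
          · have hm : m.1 = 0 := congrArg Subtype.val (eq_zero_of_mem_extendByZero h m)
            rw [hm, map_zero]
            exact localHom_map_zero f h'
          · rfl } (by
      intro V a m
      change (if h : V.unop ≤ U then f.1 ⟨V.unop, h⟩ (a • m.1) else 0 : Sec J V.unop) =
          a • (if h : V.unop ≤ U then f.1 ⟨V.unop, h⟩ m.1 else 0 : Sec J V.unop)
      split_ifs with h
      · exact (f.2 V.unop h).2.1 _ _
      · exact (smul_zero a).symm)

/-- An injective sheaf of modules has the extension property for the morphisms that are
injective on an open subset. -/
lemma exists_extension {N' N J : SheafOfModules.{u} A.toRing} [Injective J] (g : N' ⟶ N)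
    (U : Opens X) (hg : ∀ V ≤ U, Function.Injective (app g V)) (f : localHom k A N' J U) :
    ∃ h : N ⟶ J, ∀ (V : Opens X) (hV : V ≤ U) (m : Sec N' V), app h V (app g V m) = f.1 ⟨V, hV⟩ m := by
  -- Cutting `N'` down to the open subsets of `U` turns injectivity of `g` over `U` into a
  -- monomorphism of presheaves on all of `X`.
  let i : (extendByZero N' U).toPresheafOfModules ⟶ N.val := (extendByZero N' U).ι ≫ g.val
  have : Mono i := by
    refine PresheafOfModules.mono_of_injective fun V m m' h => ?_
    by_cases hV : V.unop ≤ U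
    · exact Subtype.ext (hg V.unop hV h)
    · exact (eq_zero_of_mem_extendByZero hV m).trans (eq_zero_of_mem_extendByZero hV m').symm
  have := injective_val J
  refine ⟨⟨Injective.factorThru (extendByZeroDesc f) i⟩, fun V hV m => ?_⟩
  have h := congrArg (fun F => (F.app (op V)).hom ⟨m, mem_extendByZero hV m⟩)
    (Injective.comp_factorThru (extendByZeroDesc f) i)
  refine Eq.trans h ?_
  exact dif_pos hV

/-- The local morphism on `U` that is defined by a section of `J` on `U`. -/
def localHomOfSection {J : SheafOfModules.{u} A.toRing} {U : Opens X} (s : Sec J U) :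
    localHom k A (SheafOfModules.unit A.toRing) J U :=
  ⟨fun V (a : RSec A.toRing V.1) => (a • res J V.2 s : Sec J V.1), by
    intro V hV
    refine ⟨fun (a b : RSec A.toRing V) => add_smul a b (res J hV s),
      fun (a b : RSec A.toRing V) => mul_smul a b (res J hV s), fun W hW a => ?_⟩
    have h := res_smul hW (show RSec A.toRing V from a) (res J hV s)
    rw [res_res] at h
    exact h.symm⟩

/-- A morphism of sheaves of modules as a local morphism. -/
def localHomOfHom (k : Type u) [CommRing k] [Algebra k K] {M N : SheafOfModules.{u} A.toRing}
    (h : M ⟶ N) (U : Opens X) : localHom k A M N U :=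
  ⟨fun V => app h V.1, fun V _ => ⟨map_add (app h V), map_smul (app h V),
    fun _ h' m => app_res h h' m⟩⟩

/-- A section on `V` is a morphism on `V` from the free module of rank one. Extended to all of `X`,
this morphism takes at `1` a value on `U` that extends the section. The ring `k` only serves to
speak of local morphisms. -/
lemma isFlabbyOn_of_injective (k : Type u) [CommRing k] [Algebra k K]
    (J : SheafOfModules.{u} A.toRing) [Injective J] (O : Opens X) :
    IsFlabbyOn ((SheafOfModules.toSheaf _).obj J) O := by
  intro V U hVU _ s
  obtain ⟨h, hh⟩ := exists_extension (k := k) (J := J) (𝟙 (SheafOfModules.unit A.toRing)) V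
    (fun _ _ _ _ h => h) (localHomOfSection s)
  refine ⟨app h U (1 : RSec A.toRing U), ?_⟩
  have e := hh V le_rfl (1 : RSec A.toRing V)
  have e' := app_res h hVU (1 : RSec A.toRing U)
  have e₁ : res (SheafOfModules.unit A.toRing) hVU (1 : RSec A.toRing U) =
    (1 : RSec A.toRing V) := map_one (rres A.toRing hVU)
  rw [e₁] at e'
  refine e'.symm.trans (e.trans ?_)
  exact (one_smul (RSec A.toRing V) _).trans (res_self s)

/-- The sheaf of morphisms to an injective sheaf of modules is flabby. -/
lemma localHomRes_surjective (N J : SheafOfModules.{u} A.toRing) [Injective J] {V U : Opens X}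
    (hVU : V ≤ U) : Function.Surjective (localHomRes k A N J hVU) := by
  intro f
  obtain ⟨h, hh⟩ := exists_extension (J := J) (𝟙 N) V (fun _ _ _ _ h => h) f
  exact ⟨localHomOfHom k h U, Subtype.ext (funext fun W => funext fun m => hh W.1 W.2 m)⟩

end Injective

/-! ### Classes adapted to direct images -/

section Push

variable {X Y : TopCat.{u}}

lemma isSectionwiseExact_toSheaf {R : RingSheaf X} {S : ShortComplex (SheafOfModules.{u} R)}
    (hS : S.ShortExact) : IsSectionwiseExact ((SheafOfModules.toSheaf R).map S.f)
      ((SheafOfModules.toSheaf R).map S.g) where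
  comp_eq_zero U s := congrArg (fun f => app f U s) S.zero
  exact U s hs := app_exact hS U s hs
  locally_surjective U t x hx := by
    have := hS.epi_g
    exact app_locally_surjective S.g U t x hx

/-- Forget the `k`-module structure. -/
abbrev kSheafToAb (k : Type u) [CommRing k] (X : TopCat.{u}) : KSheaf k X ⥤ AbSheaf X :=
  sheafCompose _ (forget₂ (ModuleCat.{u} k) Ab.{u})

lemma isSectionwiseExact_kSheafToAb {k : Type u} [CommRing k] {S : ShortComplex (KSheaf k X)}
    (hS : S.ShortExact) :
    IsSectionwiseExact ((kSheafToAb k X).map S.f) ((kSheafToAb k X).map S.g) where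
  comp_eq_zero U s := congrArg (fun f => (f.hom.app (op U)).hom s) S.zero
  exact U s hs := kSheaf_app_exact hS U s hs
  locally_surjective U t x hx := by
    exact (kSheaf_epi_iff S.g).1 hS.epi_g U t x hx

/-- Sections on `W` are morphisms from the free presheaf on the presheaf represented by `W`. For `V
≤ U` the map between these free presheaves is a monomorphism, and `J` is injective as a presheaf. -/
lemma kSheaf_isFlabbyOn_of_injective {k : Type u} [CommRing k] (J : KSheaf k X) [Injective J]
    (O : Opens X) : IsFlabbyOn ((kSheafToAb k X).obj J) O := by
  have hJ : Injective ((sheafToPresheaf _ _).obj J) :=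
    Injective.injective_of_adjoint (sheafificationAdjunction _ _) J
  intro V U hVU _ (s : J.obj.obj (op V))
  let F : Opens X → (Opens X)ᵒᵖ ⥤ ModuleCat.{u} k := fun W => yoneda.obj W ⋙ ModuleCat.free k
  let i : F V ⟶ F U := Functor.whiskerRight (yoneda.map (homOfLE hVU)) (ModuleCat.free k)
  have hi : Mono i := by
    rw [NatTrans.mono_iff_mono_app]
    intro W
    rw [ModuleCat.mono_iff_injective]
    exact Finsupp.mapDomain_injective fun (a b : W.unop ⟶ V) _ => Subsingleton.elim a b
  let e : ∀ W, (F W ⟶ J.obj) ≃ J.obj.obj (op W) := fun W =>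
    (((ModuleCat.adj k).whiskerRight _).homEquiv (yoneda.obj W) J.obj).trans yonedaEquiv
  let h : F U ⟶ J.obj := Injective.factorThru (J := (sheafToPresheaf _ _).obj J) ((e V).symm s) i
  have hh : i ≫ h = (e V).symm s :=
    Injective.comp_factorThru (J := (sheafToPresheaf _ _).obj J) ((e V).symm s) i
  refine ⟨e U h, ?_⟩
  have h₁ : e V (i ≫ h) = s := (congrArg (e V) hh).trans ((e V).apply_symm_apply s)
  refine Eq.trans ?_ h₁
  have h₂ := ((ModuleCat.adj k).whiskerRight (Opens X)ᵒᵖ).homEquiv_naturality_left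
    (yoneda.map (homOfLE hVU)) h
  refine Eq.trans ?_ (congrArg yonedaEquiv h₂).symm
  exact yonedaEquiv_naturality (F := J.obj ⋙ forget (ModuleCat.{u} k))
    (((ModuleCat.adj k).whiskerRight (Opens X)ᵒᵖ).homEquiv (yoneda.obj U) J.obj h) (homOfLE hVU)

/-- The class of flabby sheaves is adapted to the direct image functor. -/
lemma isAdapted_pushK (k : Type u) [CommRing k] (f : X ⟶ Y) :
    (pushK k f).IsAdapted (fun F => IsFlabbyOn ((kSheafToAb k X).obj F) ⊤) where
  of_injective I _ := kSheaf_isFlabbyOn_of_injective I ⊤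
  of_shortExact S hS h₁ h₂ := (isSectionwiseExact_kSheafToAb hS).isFlabbyOn h₁ h₂
  map_shortExact S hS h₁ := by
    apply kSheaf_shortExact
    · intro U
      have := hS.mono_f
      exact kSheaf_app_injective S.f _
    · intro U s hs
      exact kSheaf_app_exact hS _ s hs
    · intro U t x hx
      obtain ⟨s, hs⟩ := (isSectionwiseExact_kSheafToAb hS).surjective_of_isFlabbyOn h₁ le_top t
      refine ⟨U, le_rfl, s, hx, ?_⟩
      have e := ares_self ((kSheafToAb k X).obj S.X₃) t
      exact hs.trans e.symm

instance pushMod_additive (f : X ⟶ Y) {R : RingSheaf Y} {A : RingSheaf X}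
    (φ : pullRing f R ⟶ A) : (pushMod f φ).Additive where
  map_add := rfl

/-- For a continuous section `ι` of `f` with closed image, the sheaves of modules that are flabby
outside of the image of `ι` are adapted to the direct image functor. -/
lemma isAdapted_pushMod {K : Type w} [CommRing K] {k : Type u} [CommRing k] [Algebra k K]
    {A : AlgSheaf K X} (f : X ⟶ Y) (ι : Y ⟶ X) (hι : ι ≫ f = 𝟙 Y)
    (O : Opens X) (hO : (O : Set X) = (Set.range ι)ᶜ) {R : RingSheaf Y}
    (φ : pullRing f R ⟶ A.toRing) : (pushMod f φ).IsAdapted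
      (fun M => IsFlabbyOn ((SheafOfModules.toSheaf _).obj M) O) where
  of_injective I _ := isFlabbyOn_of_injective k I O
  of_shortExact S hS h₁ h₂ := (isSectionwiseExact_toSheaf hS).isFlabbyOn h₁ h₂
  map_shortExact S hS h₁ := by
    have hmono := hS.mono_f
    have hex := isSectionwiseExact_toSheaf hS
    refine @ShortComplex.ShortExact.mk _ _ _ _
      (hS.exact.map_of_mono_of_preservesKernel _ hmono inferInstance) ?_ ?_
    · change Mono ((pushMod f φ).map S.f)
      infer_instance
    · change Epi ((pushMod f φ).map S.g)
      apply epi_of_locally_surjective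
      intro U t₀ y hy
      let t : ((SheafOfModules.toSheaf _).obj S.X₃).obj.obj (op ((Opens.map f).obj U)) := t₀
      have hfι : ∀ y, f (ι y) = y := fun y => ConcreteCategory.congr_hom hι y
      -- A lift on a neighbourhood `W` of the single point `ι y` of the fibre suffices: the rest of
      -- the section will be treated by flabbiness off the image of `ι`.
      obtain ⟨W, hW, s, hxW, hs⟩ := hex.locally_surjective ((Opens.map f).obj U) t (ι y)
        (show f (ι y) ∈ U by rwa [hfι])
      let U' : Opens Y := (Opens.map ι).obj W
      have hU' : U' ≤ U := fun z hz => by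
        have : f (ι z) ∈ U := hW hz
        rwa [hfι] at this
      have hle : (Opens.map f).obj U' ≤ (Opens.map f).obj U := fun z hz => hU' hz
      -- The neighbourhood `U'` of `y` consists of the points whose image under `ι` is in `W`. Hence
      -- `W` and `O` together cover its inverse image, and the two lifts glue because the sections
      -- of `S.X₁` extend inside `O`.
      obtain ⟨s', hs'⟩ := hex.surjective_of_isFlabbyOn h₁ (U := O ⊓ (Opens.map f).obj U')
        inf_le_left (ares _ (inf_le_right.trans hle) t)
      have hV : W ⊓ (Opens.map f).obj U' ≤ (Opens.map f).obj U := inf_le_left.trans hW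
      obtain ⟨r, -, hr⟩ := hex.glue_lifts (V := W ⊓ (Opens.map f).obj U') hV
        (inf_le_right.trans hle) t (ares _ inf_le_left s) (by
          rw [abSheaf_app_ares, hs, ares_ares]) s' hs' (h₁ _ _ _ inf_le_left)
      have hcov : (Opens.map f).obj U' ≤
          W ⊓ (Opens.map f).obj U' ⊔ O ⊓ (Opens.map f).obj U' := by
        intro z hz
        by_cases hzι : z ∈ Set.range ι
        · obtain ⟨z', rfl⟩ := hzι
          refine Or.inl ⟨?_, hz⟩
          have : ι (f (ι z')) ∈ W := hz
          rwa [hfι] at this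
        · refine Or.inr ⟨?_, hz⟩
          have : z ∈ (O : Set X) := by rw [hO]; exact hzι
          exact this
      refine ⟨U', hU', ares _ hcov r, hxW, ?_⟩
      have h := abSheaf_app_ares ((SheafOfModules.toSheaf _).map S.g) hcov r
      rw [hr, ares_ares] at h
      exact h

end Push

/-! ### Direct image of the restriction of a module to an open subset -/

section SectionsOn

variable {X : TopCat.{u}} {R : RingSheaf X}

/-- Intersection with a fixed open subset. -/
abbrev infOpens (W : Opens X) : Opens X ⥤ Opens X where
  obj V := V ⊓ W
  map i := homOfLE (inf_le_inf_right W i.le)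

/-- The restriction morphism from a sheaf of rings to its direct image from an open subset. -/
abbrev toInfOpens (R : RingSheaf X) (W : Opens X) : R.obj ⟶ (infOpens W).op ⋙ R.obj where
  app V := R.obj.map (homOfLE (inf_le_left : V.unop ⊓ W ≤ V.unop)).op
  naturality _ _ i := by
    dsimp
    rw [← R.obj.map_comp, ← R.obj.map_comp]
    rfl

/-- The sheaf of modules `V ↦ N (V ∩ W)`. -/
def sectionsOn (N : SheafOfModules.{u} R) (W : Opens X) : SheafOfModules.{u} R where
  val := (PresheafOfModules.pushforward (toInfOpens R W)).obj N.val
  isSheaf := by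
    change TopCat.Presheaf.IsSheaf (X := X) _
    rw [TopCat.Presheaf.isSheaf_iff_isSheaf_comp (forget Ab.{u})]
    apply TopCat.Presheaf.isSheaf_of_isSheafUniqueGluing_types
    intro ι U (s : ∀ i, Sec N (U i ⊓ W)) hs
    have hle : ∀ i, U i ⊓ W ≤ iSup U ⊓ W := fun i => inf_le_inf_right W (le_iSup U i)
    have hcov : iSup U ⊓ W ≤ ⨆ i, U i ⊓ W := by rw [iSup_inf_eq]
    obtain ⟨t, ht⟩ := sec_glue (M := N) (fun i => U i ⊓ W) (iSup U ⊓ W) hle hcov s (by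
      intro i j V hi hj
      have h : res N (inf_le_inf_right W inf_le_left : (U i ⊓ U j) ⊓ W ≤ U i ⊓ W) (s i) =
        res N (inf_le_inf_right W inf_le_right : (U i ⊓ U j) ⊓ W ≤ U j ⊓ W) (s j) := hs i j
      have h' := congrArg (res N (show V ≤ (U i ⊓ U j) ⊓ W from
        le_inf (le_inf (hi.trans inf_le_left) (hj.trans inf_le_left)) (hi.trans inf_le_right))) h
      rwa [res_res, res_res] at h')
    refine ⟨t, ht, fun t' ht' => ?_⟩
    exact sec_ext (M := N) (fun i => U i ⊓ W) (iSup U ⊓ W) hle hcov t' t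
      fun i => (ht' i).trans (ht i).symm

/-- The sections of `sectionsOn N W` on an open subset of `W` are sections of `N`. -/
def sectionsOnTo (N : SheafOfModules.{u} R) {W V : Opens X} (hV : V ≤ W) :
    Sec (sectionsOn N W) V →+ Sec N V where
  toFun (s : Sec N (V ⊓ W)) := res N (le_inf le_rfl hV) s
  map_zero' := map_zero (res N (le_inf le_rfl hV))
  map_add' := map_add (res N (le_inf le_rfl hV))

variable {N : SheafOfModules.{u} R}

lemma sectionsOnTo_smul {W V : Opens X} (hV : V ≤ W) (a : RSec R V) (s : Sec (sectionsOn N W) V) :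
    sectionsOnTo N hV (a • s) = a • sectionsOnTo N hV s := by
  have h := res_smul (M := N) (le_inf le_rfl hV : V ≤ V ⊓ W) (rres R inf_le_left a) s
  refine h.trans (congrArg (fun b : RSec R V => b • sectionsOnTo N hV s) ?_)
  have := ConcreteCategory.congr_hom (R.obj.map_comp (homOfLE (inf_le_left : V ⊓ W ≤ V)).op
    (homOfLE (le_inf le_rfl hV : V ≤ V ⊓ W)).op) a
  exact this.symm.trans (ConcreteCategory.congr_hom (R.obj.map_id (op V)) a)

lemma sectionsOnTo_res {W V V' : Opens X} (hV : V ≤ W) (h : V' ≤ V) (s : Sec (sectionsOn N W) V) :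
    sectionsOnTo N (h.trans hV) (res _ h s) = res N h (sectionsOnTo N hV s) := by
  change Sec N (V ⊓ W) at s
  change res N (le_inf le_rfl (h.trans hV)) (res N (inf_le_inf_right W h) s) =
    res N h (res N (le_inf le_rfl hV) s)
  rw [res_res, res_res]

end SectionsOn

/-! ### The adjunction of extension of scalars for local morphisms -/

section LocalAdjunction

variable {X Y : TopCat.{u}} (f : X ⟶ Y)

/-- The unit `M ⟶ f_* (A ⊗_{f⁻¹ R} f⁻¹ M)` of the extension of scalars. -/
abbrev extUnit {R : RingSheaf Y} {A : RingSheaf X} (φ : pullRing f R ⟶ A)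
    (M : SheafOfModules.{u} R) : M ⟶ (pushMod f φ).obj ((extendScalars f φ).obj M) :=
  (SheafOfModules.pullbackPushforwardAdjunction (adjRing f φ)).unit.app M

variable {K : Type w} [CommRing K] {k : Type u} [CommRing k] [Algebra k K]

variable {K' : Type*} [CommRing K'] {k' : Type u} [CommRing k'] [Algebra k' K']
  {R : AlgSheaf K Y} {A : AlgSheaf K' X} (φ : pullRing f R.toRing ⟶ A.toRing)
  {M : SheafOfModules.{u} R.toRing} {J : SheafOfModules.{u} A.toRing}

/-- The extension to global morphisms of a local morphism. -/
def homOfLocalHom {M N : SheafOfModules.{u} R.toRing} {W : Opens Y} (g : localHom k R M N W) :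
    M ⟶ sectionsOn N W where
  val := PresheafOfModules.homMk
    { app V := AddCommGrpCat.ofHom
        { toFun (m : Sec M V.unop) := (g.1 ⟨V.unop ⊓ W, inf_le_right⟩ (res M inf_le_left m) :
            Sec N (V.unop ⊓ W))
          map_zero' := by rw [map_zero]; exact localHom_map_zero g _
          map_add' m m' := by
            rw [map_add]
            exact (g.2 (V.unop ⊓ W) inf_le_right).1 _ _ }
      naturality V V' i := by
        ext m
        change Sec M V.unop at m
        change g.1 ⟨V'.unop ⊓ W, inf_le_right⟩ (res M inf_le_left (res M i.unop.le m)) =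
          res N (inf_le_inf_right W i.unop.le) (g.1 ⟨V.unop ⊓ W, inf_le_right⟩ (res M inf_le_left m))
        rw [res_res]
        refine Eq.trans ?_ ((g.2 (V.unop ⊓ W) inf_le_right).2.2 _ _ _)
        rw [res_res] } (by
      intro V (a : RSec R.toRing V.unop) (m : Sec M V.unop)
      change g.1 ⟨V.unop ⊓ W, inf_le_right⟩ (res M inf_le_left (a • m)) =
        rres R.toRing (inf_le_left : V.unop ⊓ W ≤ V.unop) a • g.1 ⟨V.unop ⊓ W, inf_le_right⟩ (res M inf_le_left m)
      rw [res_smul]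
      exact (g.2 (V.unop ⊓ W) inf_le_right).2.1 _ _)

/-- A local morphism to a direct image, as a global morphism. -/
def homOfLocalHomPush {W : Opens Y} (g : localHom k R M ((pushMod f φ).obj J) W) :
    M ⟶ (pushMod f φ).obj (sectionsOn J ((Opens.map f).obj W)) where
  val := PresheafOfModules.homMk
    { app V := AddCommGrpCat.ofHom
        { toFun (m : Sec M V.unop) := (g.1 ⟨V.unop ⊓ W, inf_le_right⟩ (res M inf_le_left m) :
            Sec ((pushMod f φ).obj J) (V.unop ⊓ W))
          map_zero' := by rw [map_zero]; exact localHom_map_zero g _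
          map_add' m m' := by
            rw [map_add]
            exact (g.2 (V.unop ⊓ W) inf_le_right).1 _ _ }
      naturality V V' i := by
        ext m
        change Sec M V.unop at m
        change g.1 ⟨V'.unop ⊓ W, inf_le_right⟩ (res M inf_le_left (res M i.unop.le m)) =
          res ((pushMod f φ).obj J) (inf_le_inf_right W i.unop.le)
            (g.1 ⟨V.unop ⊓ W, inf_le_right⟩ (res M inf_le_left m))
        rw [res_res]
        refine Eq.trans ?_ ((g.2 (V.unop ⊓ W) inf_le_right).2.2 _ _ _)
        rw [res_res] } (by
      intro V (a : RSec R.toRing V.unop) (m : Sec M V.unop)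
      have h : g.1 ⟨V.unop ⊓ W, inf_le_right⟩ (res M inf_le_left (a • m)) =
        rres R.toRing (inf_le_left : V.unop ⊓ W ≤ V.unop) a • g.1 ⟨V.unop ⊓ W, inf_le_right⟩ (res M inf_le_left m) := by
        rw [res_smul]
        exact (g.2 (V.unop ⊓ W) inf_le_right).2.1 _ _
      refine h.trans ?_
      have e := ConcreteCategory.congr_hom
        ((adjRing f φ).hom.naturality (homOfLE (inf_le_left : V.unop ⊓ W ≤ V.unop)).op) a
      exact congrArg (fun b : RSec A.toRing ((Opens.map f).obj (V.unop ⊓ W)) =>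
        b • (show Sec J ((Opens.map f).obj (V.unop ⊓ W)) from
          g.1 ⟨V.unop ⊓ W, inf_le_right⟩ (res M inf_le_left m))) e)

variable (M J) in
/-- The composition of the local morphisms with the unit of the extension of scalars. -/
def localHomComp (W : Opens Y)
    (h : localHom k' A ((extendScalars f φ).obj M) J ((Opens.map f).obj W)) :
    localHom k R M ((pushMod f φ).obj J) W :=
  ⟨fun V m => h.1 ⟨(Opens.map f).obj V.1, fun _ hx => V.2 hx⟩ (app (extUnit f φ M) V.1 m), by
    intro V hV
    have hV' : (Opens.map f).obj V ≤ (Opens.map f).obj W := fun _ hx => hV hx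
    refine ⟨fun m m' => ?_, fun a m => ?_, fun V' h' m => ?_⟩
    · exact (congrArg (h.1 ⟨_, hV'⟩) (map_add (app (extUnit f φ M) V) m m')).trans
        ((h.2 _ hV').1 _ _)
    · exact (congrArg (h.1 ⟨_, hV'⟩) (map_smul (app (extUnit f φ M) V) a m)).trans
        ((h.2 _ hV').2.1 _ _)
    · have hV'' : (Opens.map f).obj V' ≤ (Opens.map f).obj V := fun _ hx => h' hx
      exact (congrArg (h.1 ⟨_, hV''.trans hV'⟩) (app_res (extUnit f φ M) h' m)).trans
        ((h.2 _ hV').2.2 _ hV'' _)⟩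

lemma extUnit_hom_ext {N : SheafOfModules.{u} A.toRing} {F G : (extendScalars f φ).obj M ⟶ N}
    (h : ∀ (V : Opens Y) (m : Sec M V),
      app F ((Opens.map f).obj V) (app (extUnit f φ M) V m) =
        app G ((Opens.map f).obj V) (app (extUnit f φ M) V m)) : F = G := by
  apply ((SheafOfModules.pullbackPushforwardAdjunction (adjRing f φ)).homEquiv _ _).injective
  rw [Adjunction.homEquiv_unit, Adjunction.homEquiv_unit]
  apply SheafOfModules.hom_ext
  apply PresheafOfModules.hom_ext
  rintro ⟨V⟩
  ext m
  exact h V m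

lemma exists_extUnit_desc {N : SheafOfModules.{u} A.toRing} (G : M ⟶ (pushMod f φ).obj N) :
    ∃ F : (extendScalars f φ).obj M ⟶ N, ∀ (V : Opens Y) (m : Sec M V),
      app F ((Opens.map f).obj V) (app (extUnit f φ M) V m) = app G V m := by
  refine ⟨((SheafOfModules.pullbackPushforwardAdjunction (adjRing f φ)).homEquiv _ _).symm G,
    fun V m => ?_⟩
  have h := ((SheafOfModules.pullbackPushforwardAdjunction (adjRing f φ)).homEquiv M N).apply_symm_apply G
  rw [Adjunction.homEquiv_unit] at h
  exact congrArg (fun F => app F V m) h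

/-- A local morphism to `J` over `f⁻¹ W` is the same as a global one to `sectionsOn J (f⁻¹ W)`, and
global morphisms out of an extension of scalars are determined by their composition with the unit.
-/
lemma localHomComp_injective (W : Opens Y) :
    Function.Injective (localHomComp (k := k) (k' := k') f φ M J W) := by
  intro h₁ h₂ e
  have key : homOfLocalHom h₁ = homOfLocalHom h₂ := by
    apply extUnit_hom_ext
    intro V m
    have aux : ∀ h : localHom k' A ((extendScalars f φ).obj M) J ((Opens.map f).obj W),
        app (homOfLocalHom h) ((Opens.map f).obj V) (app (extUnit f φ M) V m) =
        (localHomComp (k := k) (k' := k') f φ M J W h).1 ⟨V ⊓ W, inf_le_right⟩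
          (res M inf_le_left m) := by
      intro h
      -- The inverse image of `V ⊓ W` is the intersection of the inverse images, so the unit can be
      -- moved across the restriction.
      have h' := app_res (extUnit f φ M) (inf_le_left : V ⊓ W ≤ V) m
      exact congrArg (h.1 ⟨(Opens.map f).obj (V ⊓ W), fun _ hx => hx.2⟩) h'.symm
    rw [aux, aux, e]
  refine Subtype.ext (funext fun V => funext fun m => ?_)
  have h₃ : h₁.1 ⟨V.1 ⊓ (Opens.map f).obj W, inf_le_right⟩ (res _ inf_le_left m) =
    h₂.1 ⟨V.1 ⊓ (Opens.map f).obj W, inf_le_right⟩ (res _ inf_le_left m) :=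
    congrArg (fun F => app F V.1 m) key
  have h₄ := ((h₁.2 V.1 V.2).2.2 _ inf_le_left m).symm.trans
    (h₃.trans ((h₂.2 V.1 V.2).2.2 _ inf_le_left m))
  have h₅ := congrArg (res J (le_inf le_rfl V.2)) h₄
  rw [res_res, res_res, res_self, res_self] at h₅
  exact h₅

/-- Extend the local morphism to a global one into the direct image of `sectionsOn J (f⁻¹ W)`, take
its adjoint, and read the values of the latter inside `f⁻¹ W` as sections of `J`. -/
lemma localHomComp_surjective (W : Opens Y) :
    Function.Surjective (localHomComp (k := k) (k' := k') f φ M J W) := by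
  intro g
  obtain ⟨F, hF⟩ := exists_extUnit_desc f φ (homOfLocalHomPush f φ g)
  refine ⟨⟨fun V m => sectionsOnTo J V.2 (app F V.1 m), ?_⟩, ?_⟩
  · intro V hV
    refine ⟨fun m m' => ?_, fun a m => ?_, fun V' h' m => ?_⟩
    · exact (congrArg (sectionsOnTo J hV) (map_add (app F V) m m')).trans (map_add _ _ _)
    · exact (congrArg (sectionsOnTo J hV) (map_smul (app F V) a m)).trans (sectionsOnTo_smul hV _ _)
    · exact (congrArg (sectionsOnTo J _) (app_res F h' m)).trans (sectionsOnTo_res hV h' _)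
  · refine Subtype.ext (funext fun V => funext fun m => ?_)
    have h₁ := hF V.1 m
    refine (congrArg (sectionsOnTo J (W := (Opens.map f).obj W) (V := (Opens.map f).obj V.1)
      fun _ hx => V.2 hx) h₁).trans ?_
    have h₂ := (g.2 V.1 V.2).2.2 (V.1 ⊓ W) inf_le_left m
    refine (congrArg (res ((pushMod f φ).obj J) (le_inf le_rfl V.2 : V.1 ≤ V.1 ⊓ W)) h₂).trans ?_
    rw [res_res, res_self]

end LocalAdjunction

/-! ### Linear equations with values in a module over a coherent ring -/

section Relations

variable {X : TopCat.{u}} {R : RingSheaf X}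

lemma rres_rres {W V U : Opens X} (h : W ≤ V) (h' : V ≤ U) (a : RSec R U) :
    rres R h (rres R h' a) = rres R (h.trans h') a := by
  have := ConcreteCategory.congr_hom (R.obj.map_comp (homOfLE h').op (homOfLE h).op) a
  exact this.symm

lemma rres_self {U : Opens X} (a : RSec R U) : rres R le_rfl a = a :=
  ConcreteCategory.congr_hom (R.obj.map_id (op U)) a

lemma res_sum_smul {M : SheafOfModules.{u} R} {V U : Opens X} (h : V ≤ U) {ι : Type*} [Fintype ι]
    (a : ι → RSec R U) (s : ι → Sec M U) :
    res M h (∑ i, a i • s i) = ∑ i, rres R h (a i) • res M h (s i) := by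
  rw [map_sum]
  exact Finset.sum_congr rfl fun i _ => res_smul h _ _

lemma sum_sum_mul_smul {B N : Type*} [Ring B] [AddCommGroup N] [Module B N] {ι κ : Type*}
    [Fintype ι] [Fintype κ] (b : κ → B) (r : κ → ι → B) (q : ι → N) :
    ∑ i, (∑ j, b j * r j i) • q i = ∑ j, b j • ∑ i, r j i • q i := by
  simp only [Finset.sum_smul, Finset.smul_sum, mul_smul]
  exact Finset.sum_comm

/-- The relations between the sections `s i` also hold between the sections `q i`. -/
def RelationsHold {M Q : SheafOfModules.{u} R} {W : Opens X} {n : ℕ} (s : Fin n → Sec M W)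
    (q : Fin n → Sec Q W) : Prop :=
  ∀ (V : Opens X) (h : V ≤ W) (a : Fin n → RSec R V),
    ∑ i, a i • res M h (s i) = 0 → ∑ i, a i • res Q h (q i) = 0

lemma RelationsHold.restrict {M Q : SheafOfModules.{u} R} {W : Opens X} {n : ℕ}
    {s : Fin n → Sec M W} {q : Fin n → Sec Q W} (hsq : RelationsHold s q) {W' : Opens X}
    (h : W' ≤ W) : RelationsHold (fun i => res M h (s i)) (fun i => res Q h (q i)) := by
  intro V hV a ha
  simp only [res_res] at ha ⊢
  exact hsq V _ a ha

/-- Every relation is locally a combination of the generating ones, and vanishing in `Q` is local.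
-/
lemma relationsHold_of_generates {M Q : SheafOfModules.{u} R} {W : Opens X} {n p : ℕ}
    {s : Fin n → Sec M W} {r : Fin p → Fin n → RSec R W} (hr : GeneratesRelations M W s r)
    {q : Fin n → Sec Q W} (hq : ∀ j, ∑ i, r j i • q i = 0) : RelationsHold s q := by
  intro V h a ha
  choose W' hW' b hx hb using fun x : V => hr.2 V h a ha x x.2
  refine sec_ext W' V hW' (fun x hx' => Opens.mem_iSup.2 ⟨⟨x, hx'⟩, hx _⟩) _ _ fun x => ?_
  rw [map_zero, res_sum_smul]
  simp only [hb, res_res]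
  rw [sum_sum_mul_smul]
  refine Finset.sum_eq_zero fun j _ => ?_
  have := congrArg (res Q ((hW' x).trans h)) (hq j)
  rw [res_sum_smul, map_zero] at this
  rw [this, smul_zero]

lemma generatesRelations_restrict {M : SheafOfModules.{u} R} {W : Opens X} {n p : ℕ}
    {s : Fin n → Sec M W} {r : Fin p → Fin n → RSec R W} (hr : GeneratesRelations M W s r)
    {W' : Opens X} (h : W' ≤ W) :
    GeneratesRelations M W' (fun i => res M h (s i)) (fun j i => rres R h (r j i)) := by
  refine ⟨fun j => ?_, fun V hV a ha x hx => ?_⟩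
  · rw [← res_sum_smul, hr.1, map_zero]
  · simp only [res_res] at ha
    obtain ⟨W₁, hW₁, b, hx, hb⟩ := hr.2 V (hV.trans h) a ha x hx
    refine ⟨W₁, hW₁, b, hx, fun i => ?_⟩
    simp only [rres_rres]
    exact hb i

/-- Sections of a sheaf of rings as sections of the free module of rank one. -/
abbrev toUnit {W : Opens X} (a : RSec R W) : Sec (SheafOfModules.unit R) W := a

lemma res_toUnit {V W : Opens X} (h : V ≤ W) (a : RSec R W) :
    res (SheafOfModules.unit R) h (toUnit a) = toUnit (rres R h a) := rfl

lemma smul_toUnit {W : Opens X} (a b : RSec R W) : a • toUnit b = toUnit (a * b) := rfl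

/-- Local solvability of the compatible systems of equations `q j = r j • s` in one unknown. -/
def HasLocalSolutions (Q : SheafOfModules.{u} R) : Prop :=
  ∀ (W : Opens X) (p : ℕ) (r : Fin p → RSec R W) (q : Fin p → Sec Q W),
    RelationsHold (fun j => toUnit (r j)) q → ∀ x ∈ W, ∃ (W' : Opens X) (h : W' ≤ W) (s : Sec Q W'),
      x ∈ W' ∧ ∀ j, res Q h (q j) = rres R h (r j) • s

/-- Local solvability of the compatible systems of equations in several unknowns. -/
lemma HasLocalSolutions.exists_solution {Q : SheafOfModules.{u} R} (hQ : HasLocalSolutions Q)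
    (hR : IsCoherent (SheafOfModules.unit R)) {n : ℕ} : ∀ (W : Opens X) (p : ℕ)
    (r : Fin p → Fin n → RSec R W) (q : Fin p → Sec Q W)
    (_ : ∀ (V : Opens X) (h : V ≤ W) (b : Fin p → RSec R V),
      (∀ i, ∑ j, b j * rres R h (r j i) = 0) → ∑ j, b j • res Q h (q j) = 0), ∀ x ∈ W,
    ∃ (W' : Opens X) (h : W' ≤ W) (s : Fin n → Sec Q W'),
      x ∈ W' ∧ ∀ j, res Q h (q j) = ∑ i, rres R h (r j i) • s i := by
  induction n with
  | zero =>
    intro W p r q hq x hx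
    refine ⟨W, le_rfl, Fin.elim0, hx, fun j => ?_⟩
    have := hq W le_rfl (Pi.single j 1) (fun i => i.elim0)
    rw [Finset.sum_eq_single j (fun i _ hi => by rw [Pi.single_eq_of_ne hi, zero_smul])
      (fun h => (h (Finset.mem_univ _)).elim), Pi.single_eq_same, one_smul] at this
    rw [this]
    exact (Finset.sum_eq_zero fun i _ => i.elim0).symm
  | succ n ih =>
    intro W p r q hq x hx
    -- Elimination of the unknown of index `0`. Combining the equations along finitely many
    -- generators `c` of the relations between its coefficients leaves a compatible system in the
    -- other `n` unknowns.
    obtain ⟨W₁, h₁, p', c, hx₁, hc⟩ := hR.finite_relations W le_top p (fun j => toUnit (r j 0)) x hx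
    have hc₁ : ∀ l, ∑ j, c l j * rres R h₁ (r j 0) = 0 := hc.1
    obtain ⟨W₂, h₂, s, hx₂, hs⟩ := ih W₁ p' (fun l i => ∑ j, c l j * rres R h₁ (r j i.succ))
      (fun l => ∑ j, c l j • res Q h₁ (q j)) (by
        intro V h b hb
        have := hq V (h.trans h₁) (fun j => ∑ l, b l * rres R h (c l j)) (by
          have key : ∀ i, ∑ j, (∑ l, b l * rres R h (c l j)) * rres R (h.trans h₁) (r j i) =
              ∑ l, b l * rres R h (∑ j, c l j * rres R h₁ (r j i)) := by
            intro i
            refine (sum_sum_mul_smul b (fun l j => rres R h (c l j))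
              (fun j => rres R (h.trans h₁) (r j i))).trans ?_
            simp only [smul_eq_mul, map_sum, map_mul, rres_rres]
          intro i
          rw [key]
          refine Fin.cases ?_ (fun i => hb i) i
          exact Finset.sum_eq_zero fun l _ => by rw [hc₁, map_zero, mul_zero])
        rw [sum_sum_mul_smul] at this
        simpa only [res_sum_smul, res_res] using this) x hx₁
    have h₂₁ := h₂.trans h₁
    -- Once the other unknowns are substituted, the right-hand sides satisfy the relations `c`: that
    -- is exactly the eliminated system. A system in one unknown remains.
    obtain ⟨W₃, h₃, s₀, hx₃, hs₀⟩ := hQ W₂ p (fun j => rres R h₂₁ (r j 0))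
      (fun j => res Q h₂₁ (q j) - ∑ i, rres R h₂₁ (r j (Fin.succ i)) • s i) (by
        have hc₂ := generatesRelations_restrict hc h₂
        simp only [res_toUnit, rres_rres] at hc₂
        refine relationsHold_of_generates hc₂ fun l => ?_
        have e := hs l
        rw [res_sum_smul] at e
        simp only [res_res] at e
        simp only [smul_sub, Finset.sum_sub_distrib]
        rw [e, ← sum_sum_mul_smul, sub_eq_zero]
        simp only [map_sum, map_mul, rres_rres]) x hx₂
    refine ⟨W₃, h₃.trans h₂₁, Fin.cons s₀ (fun i => res Q h₃ (s i)), hx₃, fun j => ?_⟩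
    have e := hs₀ j
    rw [map_sub, sub_eq_iff_eq_add, res_res, res_sum_smul] at e
    simp only [rres_rres] at e
    rw [e, Fin.sum_univ_succ]
    simp only [Fin.cons_zero, Fin.cons_succ]

lemma exists_local_lifts {M N : SheafOfModules.{u} R} (g : M ⟶ N) [Epi g] {U : Opens X} {n : ℕ}
    (t : Fin n → Sec N U) (x : X) (hx : x ∈ U) :
    ∃ (W : Opens X) (hW : W ≤ U) (s : Fin n → Sec M W), x ∈ W ∧
      ∀ i, app g W (s i) = res N hW (t i) := by
  choose W hW s hxW hs using fun i => app_locally_surjective g U (t i) x hx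
  refine ⟨U ⊓ Finset.univ.inf W, inf_le_left,
    fun i => res M (inf_le_right.trans (Finset.inf_le (Finset.mem_univ i))) (s i), ⟨hx, ?_⟩,
    fun i => ?_⟩
  · rw [Opens.coe_finset_inf]
    simp [hxW]
  · rw [app_res, hs, res_res]

/-- Local sections that satisfy given relations have local liftings that satisfy them. -/
lemma exists_lift_of_relations (hR : IsCoherent (SheafOfModules.unit R))
    {S : ShortComplex (SheafOfModules.{u} R)} (hS : S.ShortExact) (h₁ : HasLocalSolutions S.X₁)
    {W : Opens X} {p n : ℕ} (r : Fin p → Fin n → RSec R W) (t : Fin n → Sec S.X₃ W)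
    (ht : ∀ j, ∑ i, r j i • t i = 0) (x : X) (hx : x ∈ W) :
    ∃ (W' : Opens X) (h : W' ≤ W) (s : Fin n → Sec S.X₂ W'), x ∈ W' ∧
      (∀ i, app S.g W' (s i) = res S.X₃ h (t i)) ∧ ∀ j, ∑ i, rres R h (r j i) • s i = 0 := by
  have := hS.mono_f
  have := hS.epi_g
  obtain ⟨W', h, s, hx', hs⟩ := exists_local_lifts S.g t x hx
  -- An arbitrary lift violates the relations by sections `v j` of `S.X₁`. Solving the system with
  -- right-hand sides `v j` in `S.X₁` gives the correction to subtract.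
  have hu : ∀ j, ∃ v : Sec S.X₁ W', app S.f W' v = ∑ i, rres R h (r j i) • s i := by
    intro j
    apply app_exact hS
    rw [map_sum]
    simp only [map_smul, hs]
    rw [← res_sum_smul, ht, map_zero]
  choose v hv using hu
  obtain ⟨W'', h', s', hx'', hs'⟩ := h₁.exists_solution hR W' p (fun j i => rres R h (r j i)) v (by
    intro V hV b hb
    apply app_injective S.f V
    rw [map_sum, map_zero]
    simp only [map_smul, app_res, hv, res_sum_smul]
    rw [← sum_sum_mul_smul]
    exact Finset.sum_eq_zero fun i _ => by rw [hb, zero_smul]) x hx'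
  refine ⟨W'', h'.trans h, fun i => res S.X₂ h' (s i) - app S.f W'' (s' i), hx'', fun i => ?_,
    fun j => ?_⟩
  · rw [map_sub, app_res, hs, res_res, ← app_comp, S.zero]
    exact sub_zero _
  · simp only [smul_sub, Finset.sum_sub_distrib, sub_eq_zero, ← map_smul, ← map_sum]
    have e := congrArg (app S.f W'') (hs' j)
    rw [app_res, hv, res_sum_smul] at e
    simp only [rres_rres] at e
    exact e

/-- Compatibility of a system over `S.X₃` amounts locally to finitely many relations `c` on its
right-hand sides. These lift to `S.X₂` with the relations preserved, so the lifted system is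
compatible; its solution maps to one in `S.X₃`. -/
lemma HasLocalSolutions.of_shortExact (hR : IsCoherent (SheafOfModules.unit R))
    {S : ShortComplex (SheafOfModules.{u} R)} (hS : S.ShortExact) (h₁ : HasLocalSolutions S.X₁)
    (h₂ : HasLocalSolutions S.X₂) : HasLocalSolutions S.X₃ := by
  intro W p r q hrq x hx
  obtain ⟨W₁, i₁, n, c, hx₁, hc⟩ := hR.finite_relations W le_top p (fun j => toUnit (r j)) x hx
  have hrq' := hrq.restrict i₁
  obtain ⟨W₂, i₂, s, hx₂, hs, hs'⟩ := exists_lift_of_relations hR hS h₁ c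
    (fun j => res S.X₃ i₁ (q j)) (fun l => by
      have := hrq' W₁ le_rfl (c l)
      simp only [res_self] at this
      exact this (hc.1 l)) x hx₁
  obtain ⟨W₃, i₃, t, hx₃, ht⟩ := h₂ W₂ p (fun j => rres R (i₂.trans i₁) (r j)) s (by
    have hc₂ := generatesRelations_restrict hc i₂
    simp only [res_toUnit, rres_rres] at hc₂
    exact relationsHold_of_generates hc₂ hs') x hx₂
  refine ⟨W₃, i₃.trans (i₂.trans i₁), app S.g W₃ t, hx₃, fun j => ?_⟩
  have e := congrArg (app S.g W₃) (ht j)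
  rw [app_res, hs, res_res, res_res, rres_rres, map_smul] at e
  exact e

end Relations

/-! ### Morphisms from a coherent module, by generators and relations -/

section Presentation

variable {K : Type w} [CommRing K] {k : Type u} [CommRing k] [Algebra k K] {X : TopCat.{u}}
  {A : AlgSheaf K X} {M Q : SheafOfModules.{u} A.toRing}

/-- The section `t` is locally the same combination of the `q i` as `m` of the `s i`. -/
def IsSameCombination {W : Opens X} {n : ℕ} (s : Fin n → Sec M W) (q : Fin n → Sec Q W)
    {V : Opens X} (hV : V ≤ W) (m : Sec M V) (t : Sec Q V) : Prop :=
  ∀ x ∈ V, ∃ (V' : Opens X) (h : V' ≤ V) (a : Fin n → RSec A.toRing V'), x ∈ V' ∧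
    res M h m = ∑ i, a i • res M (h.trans hV) (s i) ∧
    res Q h t = ∑ i, a i • res Q (h.trans hV) (q i)

section

variable {W : Opens X} {n : ℕ} {s : Fin n → Sec M W} {q : Fin n → Sec Q W}

lemma RelationsHold.sum_eq_sum (hsq : RelationsHold s q) {V : Opens X} (h : V ≤ W)
    {a b : Fin n → RSec A.toRing V}
    (hab : ∑ i, a i • res M h (s i) = ∑ i, b i • res M h (s i)) :
    ∑ i, a i • res Q h (q i) = ∑ i, b i • res Q h (q i) := by
  have := hsq V h (a - b)
  simp only [Pi.sub_apply, sub_smul, Finset.sum_sub_distrib, sub_eq_zero] at this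
  exact this hab

/-- Two local expressions of `m` differ by a relation between the `s i`, which the `q i` satisfy
too. This uniqueness is what makes the map sending `s i` to `q i` well defined, linear and
compatible with restriction. -/
lemma IsSameCombination.eq (hsq : RelationsHold s q) {V : Opens X} {hV : V ≤ W} {m : Sec M V}
    {t t' : Sec Q V} (h : IsSameCombination s q hV m t) (h' : IsSameCombination s q hV m t') :
    t = t' := by
  choose V₁ h₁ a₁ hx₁ hm₁ ht₁ using fun x : V => h x x.2
  choose V₂ h₂ a₂ hx₂ hm₂ ht₂ using fun x : V => h' x x.2
  refine sec_ext (fun x => V₁ x ⊓ V₂ x) V (fun x => inf_le_left.trans (h₁ x))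
    (fun x hx => Opens.mem_iSup.2 ⟨⟨x, hx⟩, hx₁ _, hx₂ _⟩) _ _ fun x => ?_
  have e₁ := congrArg (res Q (inf_le_left : V₁ x ⊓ V₂ x ≤ V₁ x)) (ht₁ x)
  have e₂ := congrArg (res Q (inf_le_right : V₁ x ⊓ V₂ x ≤ V₂ x)) (ht₂ x)
  have f₁ := congrArg (res M (inf_le_left : V₁ x ⊓ V₂ x ≤ V₁ x)) (hm₁ x)
  have f₂ := congrArg (res M (inf_le_right : V₁ x ⊓ V₂ x ≤ V₂ x)) (hm₂ x)
  rw [res_res, res_sum_smul] at e₁ e₂ f₁ f₂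
  simp only [res_res] at e₁ e₂ f₁ f₂
  rw [e₁, e₂]
  exact hsq.sum_eq_sum _ (f₁.symm.trans f₂)

lemma IsSameCombination.add {V : Opens X} {hV : V ≤ W} {m m' : Sec M V} {t t' : Sec Q V}
    (h : IsSameCombination s q hV m t) (h' : IsSameCombination s q hV m' t') :
    IsSameCombination s q hV (m + m') (t + t') := by
  intro x hx
  obtain ⟨V₁, h₁, a₁, hx₁, hm₁, ht₁⟩ := h x hx
  obtain ⟨V₂, h₂, a₂, hx₂, hm₂, ht₂⟩ := h' x hx
  have e₁ := congrArg (res Q (inf_le_left : V₁ ⊓ V₂ ≤ V₁)) ht₁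
  have e₂ := congrArg (res Q (inf_le_right : V₁ ⊓ V₂ ≤ V₂)) ht₂
  have f₁ := congrArg (res M (inf_le_left : V₁ ⊓ V₂ ≤ V₁)) hm₁
  have f₂ := congrArg (res M (inf_le_right : V₁ ⊓ V₂ ≤ V₂)) hm₂
  rw [res_res, res_sum_smul] at e₁ e₂ f₁ f₂
  simp only [res_res] at e₁ e₂ f₁ f₂
  refine ⟨V₁ ⊓ V₂, inf_le_left.trans h₁, fun i => rres A.toRing inf_le_left (a₁ i) +
    rres A.toRing inf_le_right (a₂ i), ⟨hx₁, hx₂⟩, ?_, ?_⟩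
  · rw [map_add, f₁, f₂]
    simp only [add_smul, Finset.sum_add_distrib]
  · rw [map_add, e₁, e₂]
    simp only [add_smul, Finset.sum_add_distrib]

lemma IsSameCombination.smul {V : Opens X} {hV : V ≤ W} {m : Sec M V} {t : Sec Q V}
    (h : IsSameCombination s q hV m t) (a : RSec A.toRing V) :
    IsSameCombination s q hV (a • m) (a • t) := by
  intro x hx
  obtain ⟨V₁, h₁, a₁, hx₁, hm₁, ht₁⟩ := h x hx
  refine ⟨V₁, h₁, fun i => rres A.toRing h₁ a * a₁ i, hx₁, ?_, ?_⟩
  · rw [res_smul, hm₁, Finset.smul_sum]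
    simp only [mul_smul]
  · rw [res_smul, ht₁, Finset.smul_sum]
    simp only [mul_smul]

lemma IsSameCombination.restrict {V : Opens X} {hV : V ≤ W} {m : Sec M V} {t : Sec Q V}
    (h : IsSameCombination s q hV m t) {V' : Opens X} (h' : V' ≤ V) :
    IsSameCombination s q (h'.trans hV) (res M h' m) (res Q h' t) := by
  intro x hx
  obtain ⟨V₁, h₁, a₁, hx₁, hm₁, ht₁⟩ := h x (h' hx)
  refine ⟨V₁ ⊓ V', inf_le_right, fun i => rres A.toRing inf_le_left (a₁ i), ⟨hx₁, hx⟩, ?_, ?_⟩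
  · have := congrArg (res M (inf_le_left : V₁ ⊓ V' ≤ V₁)) hm₁
    rw [res_res, res_sum_smul] at this
    simp only [res_res] at this ⊢
    exact this
  · have := congrArg (res Q (inf_le_left : V₁ ⊓ V' ≤ V₁)) ht₁
    rw [res_res, res_sum_smul] at this
    simp only [res_res] at this ⊢
    exact this

/-- The local combinations of the `q i` agree on overlaps, since the relations between the `s i`
hold between the `q i`; so they glue. -/
lemma exists_isSameCombination (hs : Generates M W s) (hsq : RelationsHold s q) {V : Opens X}
    (hV : V ≤ W) (m : Sec M V) : ∃ t : Sec Q V, IsSameCombination s q hV m t := by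
  choose V₁ h₁ a hx ha using fun x : V => hs V hV m x x.2
  obtain ⟨t, ht⟩ := sec_glue V₁ V h₁ (fun x hx' => Opens.mem_iSup.2 ⟨⟨x, hx'⟩, hx _⟩)
    (fun x => ∑ i, a x i • res Q ((h₁ x).trans hV) (q i)) (by
      intro x y V' hx' hy'
      have e₁ := congrArg (res M hx') (ha x)
      have e₂ := congrArg (res M hy') (ha y)
      rw [res_res, res_sum_smul] at e₁ e₂
      rw [res_sum_smul, res_sum_smul]
      simp only [res_res] at e₁ e₂ ⊢
      exact hsq.sum_eq_sum _ (e₁.symm.trans e₂))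
  exact ⟨t, fun x hx' => ⟨V₁ ⟨x, hx'⟩, h₁ _, a _, hx _, ha _, ht _⟩⟩

lemma isSameCombination_generator (i : Fin n) : IsSameCombination s q le_rfl (s i) (q i) := by
  intro x hx
  refine ⟨W, le_rfl, Pi.single i 1, hx, ?_, ?_⟩
  all_goals
    rw [Finset.sum_eq_single i (fun j _ hj => by rw [Pi.single_eq_of_ne hj, zero_smul])
      (fun h => (h (Finset.mem_univ _)).elim), Pi.single_eq_same, one_smul]

/-- A local morphism can be defined by the images of generators, if they satisfy the relations
between the generators. -/
lemma exists_localHom_of_relationsHold (k : Type u) [CommRing k] [Algebra k K]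
    (hs : Generates M W s) (hsq : RelationsHold s q) :
    ∃ f : localHom k A M Q W, ∀ i, f.1 ⟨W, le_rfl⟩ (s i) = q i := by
  choose f hf using fun (V : {V : Opens X // V ≤ W}) m => exists_isSameCombination hs hsq V.2 m
  refine ⟨⟨f, fun V hV => ⟨fun m m' => ?_, fun a m => ?_, fun V' h' m => ?_⟩⟩, fun i => ?_⟩
  · exact (hf ⟨V, hV⟩ _).eq hsq ((hf ⟨V, hV⟩ m).add (hf ⟨V, hV⟩ m'))
  · exact (hf ⟨V, hV⟩ _).eq hsq ((hf ⟨V, hV⟩ m).smul a)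
  · exact (hf ⟨V', h'.trans hV⟩ _).eq hsq ((hf ⟨V, hV⟩ m).restrict h')
  · exact (hf ⟨W, le_rfl⟩ _).eq hsq (isSameCombination_generator i)

end

lemma localHom_sum_smul {W : Opens X} (f : localHom k A M Q W) {V : Opens X} (h : V ≤ W)
    {ι : Type*} [Fintype ι] (a : ι → RSec A.toRing V) (s : ι → Sec M V) :
    f.1 ⟨V, h⟩ (∑ i, a i • s i) = ∑ i, a i • f.1 ⟨V, h⟩ (s i) := by
  let F : Sec M V →+ Sec Q V :=
    { toFun := f.1 ⟨V, h⟩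
      map_zero' := localHom_map_zero f h
      map_add' := (f.2 V h).1 }
  refine (map_sum F _ _).trans (Finset.sum_congr rfl fun i _ => ?_)
  exact (f.2 V h).2.1 _ _

/-- Local morphisms that agree on generators are equal. -/
lemma localHom_ext {W : Opens X} {n : ℕ} {s : Fin n → Sec M W} (hs : Generates M W s)
    {f g : localHom k A M Q W} (h : ∀ i, f.1 ⟨W, le_rfl⟩ (s i) = g.1 ⟨W, le_rfl⟩ (s i)) :
    f = g := by
  refine Subtype.ext (funext fun V => funext fun m => ?_)
  choose V₁ h₁ a hx ha using fun x : V.1 => hs V.1 V.2 m x x.2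
  refine sec_ext V₁ V.1 h₁ (fun x hx' => Opens.mem_iSup.2 ⟨⟨x, hx'⟩, hx _⟩) _ _ fun x => ?_
  refine ((f.2 V.1 V.2).2.2 _ (h₁ x) m).symm.trans
    (Eq.trans ?_ ((g.2 V.1 V.2).2.2 _ (h₁ x) m))
  rw [ha, localHom_sum_smul, localHom_sum_smul]
  refine Finset.sum_congr rfl fun i _ => congrArg _ ?_
  refine ((f.2 W le_rfl).2.2 _ ((h₁ x).trans V.2) (s i)).trans
    (Eq.trans ?_ ((g.2 W le_rfl).2.2 _ ((h₁ x).trans V.2) (s i)).symm)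
  rw [h]

/-- The functor `Hom(M, -)` is exact on the short exact sequences whose first term has local
solutions, if `M` is coherent. -/
lemma homSheaf_shortExact (hR : IsCoherent (SheafOfModules.unit A.toRing)) (hM : IsCoherent M)
    {S : ShortComplex (SheafOfModules.{u} A.toRing)} (hS : S.ShortExact)
    (h₁ : HasLocalSolutions S.X₁) : (S.map (homSheaf k A M)).ShortExact := by
  have := hS.mono_f
  apply kSheaf_shortExact
  · intro U (f : localHom k A M S.X₁ U) (g : localHom k A M S.X₁ U) hfg
    refine Subtype.ext (funext fun V => funext fun m => app_injective S.f V.1 ?_)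
    exact congrArg (fun h : localHom k A M S.X₂ U => h.1 V m) hfg
  · intro U (f : localHom k A M S.X₂ U) hf
    have hf' : ∀ (V : {V : Opens X // V ≤ U}) (m : Sec M V.1),
        ∃ t : Sec S.X₁ V.1, app S.f V.1 t = f.1 V m := fun V m =>
      app_exact hS V.1 _ (congrArg (fun h : localHom k A M S.X₃ U => h.1 V m) hf)
    choose g hg using hf'
    refine ⟨(⟨g, fun V hV => ⟨fun m m' => ?_, fun a m => ?_, fun V' h' m => ?_⟩⟩ :
      localHom k A M S.X₁ U), ?_⟩
    · apply app_injective S.f V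
      rw [map_add]
      exact (hg ⟨V, hV⟩ _).trans (((f.2 V hV).1 m m').trans
        (congrArg₂ (· + ·) (hg ⟨V, hV⟩ m).symm (hg ⟨V, hV⟩ m').symm))
    · apply app_injective S.f V
      rw [map_smul]
      exact (hg ⟨V, hV⟩ _).trans (((f.2 V hV).2.1 a m).trans
        (congrArg (a • ·) (hg ⟨V, hV⟩ m).symm))
    · apply app_injective S.f V'
      rw [app_res]
      exact (hg ⟨V', h'.trans hV⟩ _).trans (((f.2 V hV).2.2 _ h' m).trans
        (congrArg (res S.X₂ h') (hg ⟨V, hV⟩ m).symm))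
    · exact Subtype.ext (funext fun V => funext fun m => hg V m)
  · intro U (f : localHom k A M S.X₃ U) x hx
    obtain ⟨W, n, s, hxW, -, hs⟩ := hM.finite_type x trivial
    have hgen : ∀ (W' : Opens X) (h : W' ≤ W), Generates M W' fun i => res M h (s i) := by
      intro W' h V hV m y hy
      simp only [res_res]
      exact hs V (hV.trans h) m y hy
    obtain ⟨W₁, i₁, p, r, hx₁, hr⟩ := hM.finite_relations (W ⊓ U) le_top n
      (fun i => res M inf_le_left (s i)) x ⟨hxW, hx⟩
    simp only [res_res] at hr
    have i₁U : W₁ ≤ U := i₁.trans inf_le_right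
    have i₁W : W₁ ≤ W := i₁.trans inf_le_left
    -- To lift `f` near `x`, lift the images of finitely many generators of `M` while keeping
    -- finitely many generating relations; the lifted images then define a morphism.
    obtain ⟨W₂, i₂, t, hx₂, ht, hrt⟩ := exists_lift_of_relations hR hS h₁ r
      (fun i => f.1 ⟨W₁, i₁U⟩ (res M i₁W (s i))) (fun j => by
        rw [← localHom_sum_smul]
        exact (congrArg (f.1 ⟨W₁, i₁U⟩) (hr.1 j)).trans (localHom_map_zero f _)) x hx₁
    have hr₂ := generatesRelations_restrict hr i₂
    simp only [res_res] at hr₂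
    obtain ⟨F, hF⟩ := exists_localHom_of_relationsHold k (hgen W₂ (i₂.trans i₁W))
      (relationsHold_of_generates hr₂ hrt)
    refine ⟨W₂, i₂.trans i₁U, F, hx₂, ?_⟩
    refine localHom_ext (f := ((homSheaf k A M).map S.g).hom.app (op W₂) F)
      (g := localHomRes k A M S.X₃ (i₂.trans i₁U) f) (hgen W₂ (i₂.trans i₁W)) fun i => ?_
    refine (congrArg (app S.g W₂) (hF i)).trans ((ht i).trans ?_)
    refine ((f.2 W₁ i₁U).2.2 _ i₂ _).symm.trans ?_
    rw [res_res]
    rfl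

end Presentation

/-! ### Subsheaves generated on an open subset and their quotients -/

section GeneratedSubsheaf

variable {X : TopCat.{u}} {R : RingSheaf X} {M : SheafOfModules.{u} R} {W : Opens X} {n : ℕ}
  (s : Fin n → Sec M W)

/-- On `W`, the section `m` is locally a combination of the `s i`. -/
def IsGeneratedBy {V : Opens X} (m : Sec M V) : Prop :=
  ∀ x ∈ V, x ∈ W → ∃ (V' : Opens X) (h : V' ≤ V) (hW : V' ≤ W) (a : Fin n → RSec R V'),
    x ∈ V' ∧ res M h m = ∑ i, a i • res M hW (s i)

variable {s}

lemma IsGeneratedBy.restrict {V : Opens X} {m : Sec M V} (hm : IsGeneratedBy s m) {V' : Opens X}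
    (h : V' ≤ V) : IsGeneratedBy s (res M h m) := by
  intro x hx hxW
  obtain ⟨V₁, h₁, hW₁, a, hx₁, ha⟩ := hm x (h hx) hxW
  refine ⟨V₁ ⊓ V', inf_le_right, inf_le_left.trans hW₁, fun i => rres R inf_le_left (a i),
    ⟨hx₁, hx⟩, ?_⟩
  have := congrArg (res M (inf_le_left : V₁ ⊓ V' ≤ V₁)) ha
  rw [res_res, res_sum_smul] at this
  simp only [res_res] at this ⊢
  exact this

lemma isGeneratedBy_of_cover {ι : Type*} {V : Opens X} (m : Sec M V) (U : ι → Opens X)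
    (hU : ∀ i, U i ≤ V) (hV : V ≤ iSup U) (h : ∀ i, IsGeneratedBy s (res M (hU i) m)) :
    IsGeneratedBy s m := by
  intro x hx hxW
  obtain ⟨i, hi⟩ := Opens.mem_iSup.1 (hV hx)
  obtain ⟨V₁, h₁, hW₁, a, hx₁, ha⟩ := h i x hi hxW
  rw [res_res] at ha
  exact ⟨V₁, h₁.trans (hU i), hW₁, a, hx₁, ha⟩

variable (s) in
/-- The sections of `M` that are generated by the `s i` on `W`, as a presheaf. -/
def generatedSubmodule : M.val.Submodule where
  obj V :=
    { carrier := {m : Sec M V.unop | IsGeneratedBy s m}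
      zero_mem' := fun x hx hxW => ⟨V.unop ⊓ W, inf_le_left, inf_le_right, 0, ⟨hx, hxW⟩, by
        rw [map_zero]
        exact (Finset.sum_eq_zero fun i _ => zero_smul _ _).symm⟩
      add_mem' := by
        intro (m : Sec M V.unop) (m' : Sec M V.unop) hm hm' x hx hxW
        obtain ⟨V₁, h₁, hW₁, a₁, hx₁, ha₁⟩ := hm x hx hxW
        obtain ⟨V₂, h₂, hW₂, a₂, hx₂, ha₂⟩ := hm' x hx hxW
        have f₁ := congrArg (res M (inf_le_left : V₁ ⊓ V₂ ≤ V₁)) ha₁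
        have f₂ := congrArg (res M (inf_le_right : V₁ ⊓ V₂ ≤ V₂)) ha₂
        rw [res_res, res_sum_smul] at f₁ f₂
        simp only [res_res] at f₁ f₂
        refine ⟨V₁ ⊓ V₂, inf_le_left.trans h₁, inf_le_left.trans hW₁,
          fun i => rres R inf_le_left (a₁ i) + rres R inf_le_right (a₂ i), ⟨hx₁, hx₂⟩, ?_⟩
        rw [map_add, f₁, f₂]
        simp only [add_smul, Finset.sum_add_distrib]
      smul_mem' := by
        intro (a : RSec R V.unop) (m : Sec M V.unop) hm x hx hxW
        obtain ⟨V₁, h₁, hW₁, a₁, hx₁, ha₁⟩ := hm x hx hxW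
        refine ⟨V₁, h₁, hW₁, fun i => rres R h₁ a * a₁ i, hx₁, ?_⟩
        rw [res_smul, ha₁, Finset.smul_sum]
        simp only [mul_smul] }
  map {V V'} i m hm := IsGeneratedBy.restrict (m := (show Sec M V.unop from m)) hm i.unop.le

variable (s) in
/-- The subsheaf of `M` of the sections that are generated by the `s i` on `W`. -/
def generatedSubsheaf : SheafOfModules.{u} R where
  val := (generatedSubmodule s).toPresheafOfModules
  isSheaf := by
    change TopCat.Presheaf.IsSheaf (X := X) _
    rw [TopCat.Presheaf.isSheaf_iff_isSheaf_comp (forget Ab.{u})]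
    apply TopCat.Presheaf.isSheaf_of_isSheafUniqueGluing_types
    intro ι U (t : ∀ i, {m : Sec M (U i) // IsGeneratedBy s m}) ht
    obtain ⟨m, hm⟩ := sec_glue (M := M) U (iSup U) (le_iSup U) le_rfl (fun i => (t i).1) (by
      intro i j V hi hj
      have h : res M (inf_le_left : U i ⊓ U j ≤ U i) (t i).1 = res M inf_le_right (t j).1 :=
        congrArg Subtype.val (ht i j)
      have h' := congrArg (res M (le_inf hi hj)) h
      rwa [res_res, res_res] at h')
    refine ⟨(⟨m, isGeneratedBy_of_cover m U (le_iSup U) le_rfl fun i => by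
      rw [hm]; exact (t i).2⟩ : {m : Sec M (iSup U) // IsGeneratedBy s m}),
      fun i => Subtype.ext (hm i), fun (m' : {m : Sec M (iSup U) // IsGeneratedBy s m}) hm' => ?_⟩
    refine Subtype.ext (sec_ext (M := M) U (iSup U) (le_iSup U) le_rfl _ _ fun i => ?_)
    exact (congrArg Subtype.val (hm' i)).trans (hm i).symm

variable (s) in
/-- The inclusion of the subsheaf generated by the `s i` on `W`. -/
def generatedSubsheafι : generatedSubsheaf s ⟶ M where
  val := (generatedSubmodule s).ι

lemma app_generatedSubsheafι_injective (V : Opens X) :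
    Function.Injective (app (generatedSubsheafι s) V) :=
  fun _ _ h => Subtype.ext h

instance mono_generatedSubsheafι : Mono (generatedSubsheafι s) where
  right_cancellation a b h := by
    apply SheafOfModules.hom_ext
    apply PresheafOfModules.hom_ext
    rintro ⟨V⟩
    ext m
    exact app_generatedSubsheafι_injective V (congrArg (fun f => app f V m) h)

lemma isGeneratedBy_app_generatedSubsheafι {V : Opens X} (m : Sec (generatedSubsheaf s) V) :
    IsGeneratedBy s (app (generatedSubsheafι s) V m) := m.2

lemma exists_app_generatedSubsheafι {V : Opens X} {m : Sec M V} (hm : IsGeneratedBy s m) :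
    ∃ m' : Sec (generatedSubsheaf s) V, app (generatedSubsheafι s) V m' = m := ⟨⟨m, hm⟩, rfl⟩

lemma isGeneratedBy_generator (i : Fin n) : IsGeneratedBy s (s i) := by
  intro x hx _
  refine ⟨W, le_rfl, le_rfl, Pi.single i 1, hx, ?_⟩
  rw [Finset.sum_eq_single i (fun j _ hj => by rw [Pi.single_eq_of_ne hj, zero_smul])
    (fun h => (h (Finset.mem_univ _)).elim), Pi.single_eq_same, one_smul]

/-- The generators, as sections of the generated subsheaf. -/
lemma exists_generators : ∃ s' : Fin n → Sec (generatedSubsheaf s) W,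
    (∀ i, app (generatedSubsheafι s) W (s' i) = s i) ∧
      Generates (generatedSubsheaf s) W s' := by
  choose s' hs' using fun i => exists_app_generatedSubsheafι (isGeneratedBy_generator (s := s) i)
  refine ⟨s', hs', fun V hV m x hx => ?_⟩
  obtain ⟨V₁, h₁, hW₁, a, hx₁, ha⟩ := isGeneratedBy_app_generatedSubsheafι m x hx (hV hx)
  refine ⟨V₁, h₁, a, hx₁, app_generatedSubsheafι_injective V₁ ?_⟩
  rw [app_res, ha, map_sum]
  simp only [map_smul, app_res, hs']

lemma generatesRelations_of_injective {N : SheafOfModules.{u} R} (g : N ⟶ M) {U : Opens X}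
    (hg : ∀ V ≤ U, Function.Injective (app g V)) {m p : ℕ} (t : Fin m → Sec N U)
    (r : Fin p → Fin m → RSec R U)
    (hr : GeneratesRelations M U (fun i => app g U (t i)) r) : GeneratesRelations N U t r := by
  refine ⟨fun j => hg U le_rfl ?_, fun V hV a ha => hr.2 V hV a ?_⟩
  · rw [map_sum, map_zero]
    simp only [map_smul]
    exact hr.1 j
  · have := congrArg (app g V) ha
    rw [map_sum, map_zero] at this
    simpa only [map_smul, app_res] using this

/-- Relations are the same in a subsheaf as in `M`. Coherence is asserted only on `W`, because the
subsheaf is subject to no condition at the points outside `W`. -/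
lemma isCoherentOn_generatedSubsheaf (hM : IsCoherent M) :
    IsCoherentOn (generatedSubsheaf s) W where
  finite_type x hx := by
    obtain ⟨s', -, hs'⟩ := exists_generators (s := s)
    exact ⟨W, n, s', hx, le_rfl, hs'⟩
  finite_relations U _ m t x hx := by
    obtain ⟨U', h, p, r, hx', hr⟩ := hM.finite_relations U le_top m
      (fun i => app (generatedSubsheafι s) U (t i)) x hx
    refine ⟨U', h, p, r, hx', generatesRelations_of_injective (generatedSubsheafι s)
      (fun V _ => app_generatedSubsheafι_injective V) _ r ?_⟩
    simp only [app_res]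
    exact hr

variable (s) in
/-- The quotient of `M` by the subsheaf generated by the `s i` on `W`. -/
abbrev generatedShortComplex : ShortComplex (SheafOfModules.{u} R) :=
  ShortComplex.mk (generatedSubsheafι s) (cokernel.π (generatedSubsheafι s))
    (cokernel.condition _)

lemma generatedShortComplex_shortExact : (generatedShortComplex s).ShortExact where
  exact := ShortComplex.exact_cokernel _
  mono_f := inferInstanceAs (Mono (generatedSubsheafι s))
  epi_g := inferInstanceAs (Epi (cokernel.π (generatedSubsheafι s)))

lemma shortExactOn_of_shortExact {S : ShortComplex (SheafOfModules.{u} R)} (hS : S.ShortExact)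
    (U : Opens X) : ShortExactOn S.f S.g U where
  injective V _ := by
    have := hS.mono_f
    exact app_injective S.f V
  comp_eq_zero V _ m := congrArg (fun f => app f V m) S.zero
  exact V _ m hm x hx := by
    obtain ⟨m', hm'⟩ := app_exact hS V m hm
    exact ⟨V, le_rfl, m', hx, by rw [hm', res_self]⟩
  surjective V _ m x hx := by
    have := hS.epi_g
    exact app_locally_surjective S.g V m x hx

/-- The quotient of a coherent sheaf of modules by a subsheaf that is generated on `W` by finitely
many sections is coherent on `W`. -/
lemma isCoherentOn_generatedQuotient (hM : IsCoherent M) :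
    IsCoherentOn (cokernel (generatedSubsheafι s)) W := by
  let π := cokernel.π (generatedSubsheafι s)
  have hker : ∀ (V : Opens X) (m : Sec M V), app π V m = 0 ↔ IsGeneratedBy s m := by
    intro V m
    constructor
    · intro h
      obtain ⟨m', rfl⟩ := app_exact (generatedShortComplex_shortExact (s := s)) V m h
      exact isGeneratedBy_app_generatedSubsheafι m'
    · intro h
      obtain ⟨m', rfl⟩ := exists_app_generatedSubsheafι h
      exact congrArg (fun f => app f V m') (cokernel.condition (generatedSubsheafι s))
  refine ⟨fun x hx => ?_, fun U hU m t x hx => ?_⟩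
  · obtain ⟨U, m, t, hxU, -, ht⟩ := hM.finite_type x trivial
    refine ⟨U ⊓ W, m, fun i => app π _ (res M inf_le_left (t i)), ⟨hxU, hx⟩, inf_le_right,
      fun V hV c y hy => ?_⟩
    obtain ⟨V₁, h₁, c', hy₁, hc'⟩ := app_locally_surjective π V c y hy
    obtain ⟨V₂, h₂, a, hy₂, ha⟩ := ht V₁ (h₁.trans (hV.trans inf_le_left)) c' y hy₁
    refine ⟨V₂, h₂.trans h₁, a, hy₂, ?_⟩
    have e := congrArg (app π V₂) ha
    rw [app_res, hc', res_res, map_sum] at e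
    simp only [map_smul] at e
    rw [e]
    refine Finset.sum_congr rfl fun i _ => ?_
    rw [← app_res, res_res]
  · obtain ⟨U₁, h₁, t', hx₁, ht'⟩ := exists_local_lifts π t x hx
    have hU₁ : U₁ ≤ W := h₁.trans hU
    -- A relation between the `t i` in the quotient is a relation in `M` between their lifts `t'`
    -- and the `s i` taken together, with the coefficients of the `s i` forgotten.
    obtain ⟨U₂, h₂, p, r, hx₂, hr⟩ := hM.finite_relations U₁ le_top (m + n)
      (Fin.append t' fun i => res M hU₁ (s i)) x hx₁
    have happ : ∀ (V : Opens X) (hV : V ≤ U₂) (b : Fin (m + n) → RSec R V),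
        ∑ i, b i • res M hV (res M h₂ (Fin.append t' (fun i => res M hU₁ (s i)) i)) =
          ∑ i, b (Fin.castAdd n i) • res M (hV.trans h₂) (t' i) +
            ∑ i, b (Fin.natAdd m i) • res M (hV.trans (h₂.trans hU₁)) (s i) := by
      intro V hV b
      rw [Fin.sum_univ_add]
      simp only [Fin.append_left, Fin.append_right, res_res]
    have hπ : ∀ (V : Opens X) (hV : V ≤ U₂) (b : Fin m → RSec R V),
        ∑ i, b i • res (cokernel (generatedSubsheafι s)) hV
          (res (cokernel (generatedSubsheafι s)) (h₂.trans h₁) (t i)) =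
        app π V (∑ i, b i • res M (hV.trans h₂) (t' i)) := by
      intro V hV b
      rw [map_sum]
      refine Finset.sum_congr rfl fun i _ => ?_
      rw [map_smul, app_res, ht', res_res, res_res]
    refine ⟨U₂, h₂.trans h₁, p, fun j i => r j (Fin.castAdd n i), hx₂, fun j => ?_,
      fun V hV a ha y hy => ?_⟩
    · have e := hπ U₂ le_rfl (fun i => r j (Fin.castAdd n i))
      simp only [res_self] at e
      rw [e, hker]
      have e' := happ U₂ le_rfl (r j)
      simp only [res_self] at e'
      rw [hr.1 j, eq_comm, add_eq_zero_iff_eq_neg] at e'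
      rw [e']
      intro z hz hzW
      refine ⟨U₂, le_rfl, h₂.trans hU₁, fun i => - r j (Fin.natAdd m i), hz, ?_⟩
      simp only [neg_smul, Finset.sum_neg_distrib, res_self]
    · rw [hπ V hV a, hker] at ha
      obtain ⟨V₁, i₁, iW, b, hy₁, hb⟩ := ha y hy (hV.trans (h₂.trans hU₁) hy)
      rw [res_sum_smul] at hb
      simp only [res_res] at hb
      obtain ⟨V₂, i₂, d, hy₂, hd⟩ := hr.2 V₁ (i₁.trans hV)
        (Fin.append (fun i => rres R i₁ (a i)) (fun i => - b i)) (by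
          rw [happ]
          simp only [Fin.append_left, Fin.append_right, neg_smul, Finset.sum_neg_distrib]
          rw [← sub_eq_add_neg, sub_eq_zero]
          exact hb) y hy₁
      refine ⟨V₂, i₂.trans i₁, d, hy₂, fun i => ?_⟩
      have := hd (Fin.castAdd n i)
      rw [Fin.append_left, rres_rres] at this
      exact this

end GeneratedSubsheaf

/-! ### The class adapted to `Hom(M, -)` -/

section HasLocalSolutions

variable {K : Type w} [CommRing K] (k : Type u) [CommRing k] [Algebra k K] {X : TopCat.{u}}
  {A : AlgSheaf K X} {Q : SheafOfModules.{u} A.toRing}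

/-- Compatible data `q` define a morphism, sending `r j` to `q j`, from the left ideal that the `r
j` generate on `W`. If it extends to the ring, the value of the extension at `1` solves the system.
-/
lemma hasLocalSolutions_of_extension (H : ∀ (W : Opens X) (p : ℕ) (r : Fin p → RSec A.toRing W)
    (f : localHom k A (generatedSubsheaf (fun j => toUnit (r j))) Q W),
    ∃ h : localHom k A (SheafOfModules.unit A.toRing) Q W, ∀ m,
      h.1 ⟨W, le_rfl⟩ (app (generatedSubsheafι _) W m) = f.1 ⟨W, le_rfl⟩ m) :
    HasLocalSolutions Q := by
  intro W p r q hrq x hx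
  obtain ⟨s, hs, hs'⟩ := exists_generators (s := fun j => toUnit (r j))
  obtain ⟨f, hf⟩ := exists_localHom_of_relationsHold k (Q := Q) (q := q) hs' (by
    intro V hV a ha
    refine hrq V hV a ?_
    have := congrArg (app (generatedSubsheafι _) V) ha
    rw [map_sum, map_zero] at this
    simpa only [map_smul, app_res, hs] using this)
  obtain ⟨h, hh⟩ := H W p r f
  refine ⟨W, le_rfl, h.1 ⟨W, le_rfl⟩ (toUnit 1), hx, fun j => ?_⟩
  have e := hh (s j)
  rw [hs, hf] at e
  have e' := (h.2 W le_rfl).2.1 (r j) (toUnit 1)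
  rw [smul_toUnit, mul_one] at e'
  rw [res_self, rres_self, ← e', e]

lemma hasLocalSolutions_of_injective (k : Type u) [CommRing k] [Algebra k K]
    (Q : SheafOfModules.{u} A.toRing) [Injective Q] : HasLocalSolutions Q := by
  refine hasLocalSolutions_of_extension k fun W p r f => ?_
  obtain ⟨h, hh⟩ := exists_extension (generatedSubsheafι fun j => toUnit (r j)) W
    (fun V _ => app_generatedSubsheafι_injective V) f
  exact ⟨localHomOfHom k h W, fun m => hh W le_rfl m⟩

lemma isAdapted_homSheaf (hR : IsCoherent (SheafOfModules.unit A.toRing))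
    {M : SheafOfModules.{u} A.toRing} (hM : IsCoherent M) :
    (homSheaf k A M).IsAdapted HasLocalSolutions where
  of_injective I _ := hasLocalSolutions_of_injective k I
  of_shortExact _ hS h₁ h₂ := HasLocalSolutions.of_shortExact hR hS h₁ h₂
  map_shortExact _ hS h₁ := homSheaf_shortExact hR hM hS h₁

end HasLocalSolutions

end DQ

/-! ### Comparison of two compositions of derived functors -/

namespace CategoryTheory.Functor

section

variable {C D : Type*} [Category* C] [Category* D] [Abelian C] [Abelian D]

/-- The complex with one object in degree zero, as a bounded below complex. -/
abbrev singlePlus (X : C) : CochainComplex.Plus C :=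
  ⟨(HomologicalComplex.single C (.up ℤ) 0).obj X, 0, inferInstance⟩

/-- The image of a complex with one object in degree zero in the derived category. -/
def singlePlusIso [HasDerivedCategory C] (X : C) :
    DerivedCategory.Plus.Q.obj (singlePlus X) ≅ (DerivedCategory.Plus.singleFunctor C 0).obj X :=
  DerivedCategory.Plus.ι.preimageIso ((DerivedCategory.singleFunctorIsoCompQ C 0).symm.app X)

/-- An additive functor commutes with the formation of complexes with one object. -/
def mapSinglePlusIso (F : C ⥤ D) [F.Additive] (X : C) :
    F.mapCochainComplexPlus.obj (singlePlus X) ≅ singlePlus (F.obj X) :=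
  (CochainComplex.plus D).fullyFaithfulι.preimageIso
    ((HomologicalComplex.singleMapHomologicalComplex F (.up ℤ) 0).app X)

/-- The isomorphism in the derived category that is defined by a quasi-isomorphism. -/
def qIsoOfQuasiIso [HasDerivedCategory C] {K L : CochainComplex.Plus C} (i : K ⟶ L)
    (hi : QuasiIso i.hom) : DerivedCategory.Plus.Q.obj K ≅ DerivedCategory.Plus.Q.obj L :=
  @asIso _ _ _ _ (DerivedCategory.Plus.Qh.map ((HomotopyCategory.Plus.quotient C).map i))
    (Localization.inverts DerivedCategory.Plus.Qh (HomotopyCategory.Plus.quasiIso C) _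
      ((HomotopyCategory.quotient_map_mem_quasiIso_iff _).2 hi))

/-- Right derived functors can be computed with complexes of injective objects. -/
def derivedObjIsoOfInjective (F : C ⥤ D) [F.Additive] [EnoughInjectives C]
    [HasDerivedCategory C] [HasDerivedCategory D] (K : CochainComplex.Plus C)
    (hK : ∀ n, Injective (K.obj.X n)) :
    DerivedCategory.Plus.Q.obj (F.mapCochainComplexPlus.obj K) ≅
      F.rightDerivedFunctorPlus.obj (DerivedCategory.Plus.Q.obj K) :=
  have : IsIso (F.rightDerivedFunctorPlusUnit.app
      ((HomotopyCategory.Plus.quotient C).obj K)) := by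
    have (n : ℤ) : Injective (((HomotopyCategory.Plus.quotient C).obj K).obj.as.X n) := hK n
    infer_instance
  @asIso _ _ _ _ (F.rightDerivedFunctorPlusUnit.app ((HomotopyCategory.Plus.quotient C).obj K))
    this

end

variable {C C' D D' : Type*} [Category* C] [Category* C'] [Category* D] [Category* D']
  [Abelian C] [Abelian C'] [Abelian D] [Abelian D']
  [EnoughInjectives C] [EnoughInjectives C'] [EnoughInjectives D]
  [HasDerivedCategory C] [HasDerivedCategory C'] [HasDerivedCategory D] [HasDerivedCategory D']
  {F : C ⥤ D} [F.Additive] {G : D ⥤ D'} [G.Additive] {P : C ⥤ C'} [P.Additive] {H : C' ⥤ D'}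
  [H.Additive] {AG : ObjectProperty D} {AP : ObjectProperty C} {AH : ObjectProperty C'}

/-- For functors such that `F ⋙ G ≅ P ⋙ H`, a comparison of the values of the derived functors at
an object that is acyclic for `P`. -/
theorem nonempty_derived_comp_iso (e : P ⋙ H ≅ F ⋙ G) (hG : G.IsAdapted AG) (hP : P.IsAdapted AP)
    (hH : H.IsAdapted AH) (hF : ∀ I, Injective I → AG (F.obj I))
    (hPH : ∀ I, Injective I → AH (P.obj I)) (X : C) (hX : AP X) :
    Nonempty (H.rightDerivedFunctorPlus.obj
        ((DerivedCategory.Plus.singleFunctor C' 0).obj (P.obj X)) ≅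
      G.rightDerivedFunctorPlus.obj (F.rightDerivedFunctorPlus.obj
        ((DerivedCategory.Plus.singleFunctor C 0).obj X))) := by
  obtain ⟨J₀, i, hi, hJ, hJ₀⟩ :=
    CochainComplex.Plus.modelCategoryQuillen.exists_quasiIso_injective (singlePlus X).obj 0
  let J : CochainComplex.Plus C := ⟨J₀, 0, hJ₀⟩
  let q : DerivedCategory.Plus.Q.obj (singlePlus X) ≅ DerivedCategory.Plus.Q.obj J :=
    qIsoOfQuasiIso (ObjectProperty.homMk i) hi
  -- Outside degree zero the terms are zero, hence injective, hence in the class.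
  have hXn : ∀ n, AP ((singlePlus X).obj.X n) := by
    intro n
    by_cases hn : n = 0
    · subst hn
      exact hX
    · exact hP.of_injective _ (HomologicalComplex.isZero_single_obj_X _ _ _ _ hn).injective
  let e' : H.mapCochainComplexPlus.obj (P.mapCochainComplexPlus.obj J) ≅
      G.mapCochainComplexPlus.obj (F.mapCochainComplexPlus.obj J) :=
    (CochainComplex.plus D').fullyFaithfulι.preimageIso
      (HomologicalComplex.Hom.isoOfComponents (fun n => e.app (J₀.X n))
        fun n m _ => (e.hom.naturality (J₀.d n m)).symm)
  -- Since `X` and the terms of its resolution `J` are both adapted to `P`, the objects `P X` and `P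
  -- J` are isomorphic in the derived category. Then `H (P J)`, which is `G (F J)` by `e`, computes
  -- both sides.
  exact ⟨H.rightDerivedFunctorPlus.mapIso ((singlePlusIso (P.obj X)).symm ≪≫
      DerivedCategory.Plus.Q.mapIso (mapSinglePlusIso P X).symm ≪≫
      hP.derivedObjIso (singlePlus X) hXn ≪≫ P.rightDerivedFunctorPlus.mapIso q ≪≫
      (hP.derivedObjIso J fun n => hP.of_injective _ (hJ n)).symm) ≪≫
    (hH.derivedObjIso (P.mapCochainComplexPlus.obj J) fun n => hPH _ (hJ n)).symm ≪≫
    DerivedCategory.Plus.Q.mapIso e' ≪≫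
    hG.derivedObjIso (F.mapCochainComplexPlus.obj J) (fun n => hF _ (hJ n)) ≪≫
    G.rightDerivedFunctorPlus.mapIso (F.derivedObjIsoOfInjective J hJ ≪≫
      F.rightDerivedFunctorPlus.mapIso (q.symm ≪≫ singlePlusIso X))⟩

end CategoryTheory.Functor

namespace DQ

attribute [local instance] secModule

/-! ### Direct images of injective modules -/

section PushInjective

variable {K : Type w} [CommRing K] (k : Type u) [CommRing k] [Algebra k K] {X Y : TopCat.{u}}
  {K' : Type*} [CommRing K'] (k' : Type u) [CommRing k'] [Algebra k' K']
  {R : AlgSheaf K Y} {A : AlgSheaf K' X} (f : X ⟶ Y) (φ : pullRing f R.toRing ⟶ A.toRing)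

lemma app_extUnit_naturality {M N : SheafOfModules.{u} R.toRing} (g : M ⟶ N) (V : Opens Y)
    (m : Sec M V) : app ((extendScalars f φ).map g) ((Opens.map f).obj V)
      (app (extUnit f φ M) V m) = app (extUnit f φ N) V (app g V m) := by
  have h := (SheafOfModules.pullbackPushforwardAdjunction (adjRing f φ)).unit.naturality g
  exact congrArg (fun F => app F V m) h.symm

include k k' in
-- This is where exactness on coherent modules enters. A morphism on `W` from a finitely generated
-- left ideal to `f_* J` is, by adjunction, a morphism to `J` on `f⁻¹ W` from the extension of
-- scalars of the ideal. It extends by injectivity of `J`, and the extension comes back by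
-- adjunction.
lemma hasLocalSolutions_pushMod (hR : IsCoherent (SheafOfModules.unit R.toRing))
    (hφ : ExactOnCoherent f φ) (J : SheafOfModules.{u} A.toRing) [Injective J] :
    HasLocalSolutions ((pushMod f φ).obj J) := by
  refine hasLocalSolutions_of_extension k fun W p r g => ?_
  obtain ⟨g', rfl⟩ := localHomComp_surjective (k' := k') f φ W g
  have hRW : IsCoherentOn (SheafOfModules.unit R.toRing) W :=
    ⟨fun x hx => ⟨W, 1, fun _ => toUnit 1, hx, le_rfl, fun V hV a y hy =>
      ⟨V, le_rfl, fun _ => (show RSec R.toRing V from a), hy, by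
        rw [res_self, Fin.sum_univ_one, res_toUnit, map_one, smul_toUnit, mul_one]⟩⟩,
      fun W' _ => hR.finite_relations W' le_top⟩
  -- The ideal and its quotient are coherent only on `W`, so the hypothesis is applied over `W`. The
  -- resulting injectivity over `f⁻¹ W` is all that `exists_extension` asks for.
  have hex := hφ W _ _ _ _ _ (isCoherentOn_generatedSubsheaf hR) hRW
    (isCoherentOn_generatedQuotient hR) (shortExactOn_of_shortExact
      (generatedShortComplex_shortExact (s := fun j => toUnit (r j))) W)
  obtain ⟨h, hh⟩ := exists_extension _ ((Opens.map f).obj W) (fun V hV => hex.injective V hV) g'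
  refine ⟨localHomComp f φ _ J W (localHomOfHom k' h _), fun m => ?_⟩
  have e := app_extUnit_naturality f φ (generatedSubsheafι fun j => toUnit (r j)) W m
  exact (congrArg (app h _) e.symm).trans (hh _ le_rfl _)

end PushInjective

/-! ### The sheaf isomorphism between `Hom(M, f_* J)` and `f_* Hom(M^A, J)` -/

section HomPush

variable {k : Type u} [CommRing k] [Algebra k (PowerSeries ℂ)] {X Y : TopCat.{u}} (f : X ⟶ Y)
  {R : AlgSheaf k Y} {A : AlgSheaf (PowerSeries ℂ) X} (φ : pullRing f R.toRing ⟶ A.toRing)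

/-- On a direct image, `k` acts through `R` on one side and through `ℂ[[ħ]]` and `A` on the other.
The two actions agree because `φ` is `k`-linear, which makes the adjunction isomorphism `k`-linear.
-/
lemma ksmul_pushMod (hφ : IsAlgHom f φ) (J : SheafOfModules.{u} A.toRing) (V : Opens Y) (c : k)
    (m : Sec J ((Opens.map f).obj V)) :
    (c • (show Sec ((pushMod f φ).obj J) V from m) : Sec ((pushMod f φ).obj J) V) =
      (c • m : Sec J ((Opens.map f).obj V)) := by
  exact congrArg (fun a : RSec A.toRing ((Opens.map f).obj V) => a • m) (hφ V c)

/-- The sheaves of morphisms from an extension of scalars. -/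
def homPushIso (hφ : IsAlgHom f φ) (M : SheafOfModules.{u} R.toRing) :
    pushMod f φ ⋙ homSheaf k R M ≅ homSheaf k A ((extendScalars f φ).obj M) ⋙ pushK k f :=
  Iso.symm <| NatIso.ofComponents (fun J => (fullyFaithfulSheafToPresheaf _ _).preimageIso
    (NatIso.ofComponents (fun W => LinearEquiv.toModuleIso
      (LinearEquiv.ofBijective
        { toFun := localHomComp (k := k) (k' := k) f φ M J W.unop
          map_add' _ _ := rfl
          map_smul' c _ := Subtype.ext (funext fun V => funext fun _ =>
            (ksmul_pushMod f φ hφ J V.1 c _).symm) }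
        ⟨localHomComp_injective f φ W.unop, localHomComp_surjective f φ W.unop⟩))
      fun _ => rfl)) fun _ => rfl

end HomPush

/-- The image of a continuous section of a continuous map on a Hausdorff space is closed. -/
lemma isClosed_range_section {X Y : TopCat.{u}} [T2Space X] {f : X ⟶ Y} {ι : Y ⟶ X}
    (hι : ι ≫ f = 𝟙 Y) : IsClosed (Set.range ι) :=
  Topology.IsClosedEmbedding.isClosed_range (f := ι) <|
    Function.LeftInverse.isClosedEmbedding (f := f)
      (fun y => ConcreteCategory.congr_hom hι y) f.hom.continuous ι.hom.continuous

lemma isFlabbyOn_homSheaf {K : Type w} [CommRing K] (k : Type u) [CommRing k] [Algebra k K]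
    {X : TopCat.{u}} {A : AlgSheaf K X} (N J : SheafOfModules.{u} A.toRing) [Injective J]
    (O : Opens X) : IsFlabbyOn ((kSheafToAb k X).obj ((homSheaf k A N).obj J)) O :=
  fun _ _ h _ => localHomRes_surjective N J h

end DQ

end

theorem proposition4
    {E : Type*} [NormedAddCommGroup E] [NormedSpace ℂ E] [FiniteDimensional ℂ E]
    {E' : Type*} [NormedAddCommGroup E'] [NormedSpace ℂ E'] [FiniteDimensional ℂ E']
    {X Λ : TopCat.{u}}
    [T2Space X] [ChartedSpace E X] [IsManifold 𝓘(ℂ, E) ω X]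
    [T2Space Λ] [ChartedSpace E' Λ] [IsManifold 𝓘(ℂ, E') ω Λ]
    (Ω : DQ.SymplecticForm E X) (A : DQ.AlgSheaf (PowerSeries ℂ) X)
    (hA : DQ.IsDQAlgebra E A) (hΩA : Ω.IsQuantizedBy A)
    (P : DQ.Polarization E' Ω A Λ)
    (k : Type u) [CommRing k] [Algebra k (PowerSeries ℂ)]
    (R : DQ.AlgSheaf k Λ) (hR : DQ.IsCoherent (SheafOfModules.unit.{u} R.toRing))
    (φ : DQ.pullRing P.π R.toRing ⟶ A.toRing) (hφ : DQ.IsAlgHom P.π φ) [Mono φ]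
    (LΛ : SheafOfModules.{u} R.toRing) (hc : DQ.IsCompatible P.π φ P.L LΛ)
    (M : SheafOfModules.{u} R.toRing) (hM : DQ.IsCoherent M) :
    Nonempty (DQ.RHom k R M LΛ ≅
      (DQ.RPush k P.π).obj (DQ.RHom k A ((DQ.extendScalars P.π φ).obj M) P.L)) := by
  obtain ⟨e⟩ := hc.iso
  let O : Opens X := ⟨(Set.range P.ι)ᶜ, (DQ.isClosed_range_section P.section_ι).isOpen_compl⟩
  -- Off its support `L` has only zero sections, so they extend trivially: this is what makes `L`
  -- acyclic for the direct image of modules.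
  have hL : DQ.IsFlabbyOn ((SheafOfModules.toSheaf _).obj P.L) O := by
    intro V U _ hU t
    have : Subsingleton (DQ.Sec P.L V) := P.simple.support V
      (Set.disjoint_left.2 fun x hx => (‹V ≤ U›.trans hU) hx)
    exact ⟨0, Subsingleton.elim (α := DQ.Sec P.L V) _ _⟩
  obtain ⟨e'⟩ := Functor.nonempty_derived_comp_iso (DQ.homPushIso P.π φ hφ M)
    (DQ.isAdapted_pushK k P.π)
    (DQ.isAdapted_pushMod (k := k) P.π P.ι P.section_ι O rfl φ)
    (DQ.isAdapted_homSheaf k hR hM)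
    (fun J _ => DQ.isFlabbyOn_homSheaf k _ J ⊤)
    (fun J _ => DQ.hasLocalSolutions_pushMod k k P.π φ hR hc.exact J) P.L hL
  -- The comparison `e'` is about `π_* L`; compatibility of the polarization replaces it by `LΛ`.
  exact ⟨(DQ.homSheaf k R M).rightDerivedFunctorPlus.mapIso
    ((DerivedCategory.Plus.singleFunctor _ 0).mapIso e.symm) ≪≫ e'⟩
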